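/- The guarded lambda-calculus $\mathsf{g}\lambda$ is the call-by-name simply typed $\lambda$-calculus with types $\mathbf N$, $\mathbf 1$, $\times$, $\mathbf 0$, $+$, $\to$, iso-recursive types $\mu\alpha.A$ with every occurrence of $\alpha$ in $A$ beneath a $\blacktriangleright$, and the modalities $\blacktriangleright$ ("later", with $\mathsf{next}$, $\circledast$, $\mathsf{prev}$) and $\blacksquare$ ("constant", applied to closed types only, with $\mathsf{box}$, $\mathsf{unbox}$, $\mathsf{box}^+$); $\mathsf{prev}$, $\mathsf{box}$ and $\mathsf{box}^+$ carry explicit substitutions for variables of constant type. Its types and terms denote objects and arrows of the topos of trees $\mathcal S$. Write $\mathsf{Str}^{\mathsf g}=\mu\alpha.\mathbf N\times\blacktriangleright\alpha$ for guarded streams, $\mathsf{Str}=\blacksquare\,\mathsf{Str}^{\mathsf g}$ for coinductive streams, $::$, $\mathsf{hd}$, $\mathsf{tl}$ (with superscript $\mathsf g$ for guarded streams) for cons, head and tail, and $\mathsf{fix}:(\blacktriangleright A\to A)\to A$ for the guarded Turing fixed point combinator. For a closed term $u:B_1\times\dots\times B_n\to B$, with each of $B_1,\dots,B_n,B$ equal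 to $\mathbf N$ or $\mathsf{Str}^{\mathsf g}$, its lifting $\mathcal L_n(\mathsf{box}\,u)$ is the function $\vec y\mapsto\mathsf{box}\,\iota.\,u\langle\mathsf{unbox}\,y_1,\dots,\mathsf{unbox}\,y_n\rangle$, in which $\mathsf{Str}^{\mathsf g}$ is replaced by $\mathsf{Str}$ and arguments and results of type $\mathbf N$ are left as they are. Let $\Sigma$ be a first-order signature over the sorts $\mathbf N$ and $\mathsf{Str}$. A behavioural differential equation for a $k$-ary stream function $f$ is a pair of terms: $h_f$ of sort $\mathbf N$ over $\Sigma$, with variables $x_1,\dots,x_k$ of sort $\mathbf N$; and $t_f$ of sort $\mathsf{Str}$ over $\Sigma$ and one more symbol $f:\mathsf{Str}^k\to\mathsf{Str}$, with variables $x_i,y_i,z_i$ ($1\le i\le k$) of sort $\mathsf{Str}$. Extend $\mathsf g\lambda$ with the symbols of $\Sigma$ as constants, reading the sort $\mathsf{Str}$ as the type $\mathsf{Str}^{\mathsf g}$. Then $(h_f,t_f)$ defines closed terms $$\Phi^{\mathsf g}_f:\blacktriangleright((\mathsf{Str}^{\mathsf g})^k\to\mathsf{Str}^{\mathsf g})\to((\mathsf{Str}^{\mathsf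 g})^k\to\mathsf{Str}^{\mathsf g}),\qquad \Phi_f:(\mathsf{Str}^k\to\mathsf{Str})\to(\mathsf{Str}^k\to\mathsf{Str}).$$ Here $$\Phi^{\mathsf g}_f=\lambda f.\lambda\vec y.\ h^{\mathsf g}_f[\mathsf{hd}^{\mathsf g}y_i/x_i]::^{\mathsf g}t^{\mathsf g}_f[(\mathsf{hd}^{\mathsf g}y_i::^{\mathsf g}\mathsf{next}\,\mathsf{zeros}^{\mathsf g})/x_i,\ \mathsf{tl}^{\mathsf g}y_i/z_i],$$ where $h^{\mathsf g}_f$ is $h_f$ with each symbol read as the corresponding constant, and $t^{\mathsf g}_f$, of type $\blacktriangleright\mathsf{Str}^{\mathsf g}$, is obtained from $t_f$ by reading the variables $x_i,y_i$ as $\mathsf{next}\,x_i,\mathsf{next}\,y_i$, the variables $z_i$ as themselves, and applications as $\mathrm{curry}(f)\circledast a_1\circledast\dots\circledast a_k$ for $f$ and as $\mathrm{curry}(\mathsf{next}\,g)\circledast a_1\circledast\dots\circledast a_n$ for a symbol $g$ of $\Sigma$. Similarly $$\Phi_f=\lambda f.\lambda\vec y.\ h_f[\mathsf{hd}\,y_i/x_i]::t_f[(\mathsf{hd}\,y_i::\mathsf{zeros})/x_i,\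 \mathsf{tl}\,y_i/z_i],$$ with ordinary application and with each symbol $g$ of $\Sigma$ read as its lifting $\mathcal L_n(\mathsf{box}\,g)$. Let $f^{\mathsf g}=\mathsf{fix}\,\Phi^{\mathsf g}_f$ and let $f=\mathcal L_k(\mathsf{box}\,f^{\mathsf g}):\mathsf{Str}^k\to\mathsf{Str}$. **Theorem.** (1) For every interpretation of $\Sigma$ in $\mathcal S$ (an arbitrary arrow $[\![\tau_1]\!]\times\dots\times[\![\tau_n]\!]\to[\![\tau]\!]$ for each symbol $g:\tau_1,\dots,\tau_n\to\tau$) the following equalities of denotations hold. The term $f^{\mathsf g}$ is a fixed point of $\Phi^{\mathsf g}_f$, i.e. $\Phi^{\mathsf g}_f(\mathsf{next}\,f^{\mathsf g})=f^{\mathsf g}$, and $u=f^{\mathsf g}$ for every closed term $u$ with $\Phi^{\mathsf g}_f(\mathsf{next}\,u)=u$. The term $f$ is a fixed point of $\Phi_f$, i.e. $\Phi_f\,f=f$. It satisfies the behavioural differential equation: for variables $y_1,\dots,y_k:\mathsf{Str}$, $$\mathsf{hd}(f\,\vec y)=h_f[\mathsf{hd}\,y_i/x_i],\qquad \mathsf{tl}(f\,\vec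 y)=t_f[(\mathsf{hd}\,y_i::\mathsf{zeros})/x_i,\ \mathsf{tl}\,y_i/z_i].$$ (2) If the symbols of $\Sigma$ are replaced by arbitrary closed $\mathsf g\lambda$-terms of the corresponding types (for instance by solutions $e^{\mathsf g}$ of previously given behavioural differential equations), then the four displayed equations $\Phi^{\mathsf g}_f(\mathsf{next}\,f^{\mathsf g})=f^{\mathsf g}$, $\Phi_f\,f=f$, and the head and tail equations hold as contextual equivalences of $\mathsf g\lambda$-terms: in every closing context of type $\mathbf N$, both sides reduce to the same value. -/

import Mathlib

namespace GLambda

/-! ### The topos of trees -/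

/-- An object of the topos of trees: sets `X 0, X 1, …` with restriction functions. (Stages are
numbered from `0` instead of `1`.) -/
structure Tree where
  obj : ℕ → Type
  res : ∀ i, obj (i + 1) → obj i

namespace Tree

/-- Arrows of the topos of trees: natural families of functions. -/
@[ext] structure Hom (X Y : Tree) where
  app : ∀ i, X.obj i → Y.obj i
  naturality : ∀ i x, Y.res i (app (i + 1) x) = app i (X.res i x)

/-- Iterated restriction. -/
def restr (X : Tree) {i j : ℕ} (h : j ≤ i) : X.obj i → X.obj j :=
  Nat.leRecOn (C := fun k => X.obj k → X.obj j) h (fun {k} g x => g (X.res k x)) id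

theorem restr_self (X : Tree) {i : ℕ} (x : X.obj i) : X.restr (le_refl i) x = x := by
  simp [restr, Nat.leRecOn_self]

theorem restr_succ (X : Tree) {i j : ℕ} (h : j ≤ i) (x : X.obj (i + 1)) :
    X.restr (Nat.le_succ_of_le h) x = X.restr h (X.res i x) := by
  unfold restr
  rw [Nat.leRecOn_succ (C := fun k => X.obj k → X.obj j) h]

theorem res_restr (X : Tree) {i j : ℕ} (h : j + 1 ≤ i) (x : X.obj i) :
    X.res j (X.restr h x) = X.restr (Nat.le_of_succ_le h) x := by
  induction i, h using Nat.le_induction with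
  | base => rw [restr_self, restr_succ X (le_refl j), restr_self]
  | succ i h ih => rw [restr_succ X h, ih, restr_succ X (Nat.le_of_succ_le h)]

/-- The constant object on a set. -/
def const (Z : Type) : Tree := ⟨fun _ => Z, fun _ z => z⟩

/-- Products, computed stagewise. -/
def prod (X Y : Tree) : Tree :=
  ⟨fun i => X.obj i × Y.obj i, fun i p => (X.res i p.1, Y.res i p.2)⟩

/-- Coproducts, computed stagewise. -/
def sum (X Y : Tree) : Tree :=
  ⟨fun i => X.obj i ⊕ Y.obj i, fun i => Sum.map (X.res i) (Y.res i)⟩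

/-- Exponentials: at stage `i`, the natural families of functions `X j → Y j` for `j ≤ i`. -/
def exp (X Y : Tree) : Tree where
  obj i := {f : ∀ j, j ≤ i → X.obj j → Y.obj j //
    ∀ j (h : j + 1 ≤ i) x, Y.res j (f (j + 1) h x) = f j (Nat.le_of_succ_le h) (X.res j x)}
  res _ f := ⟨fun j h => f.1 j (Nat.le_succ_of_le h), fun j h x => f.2 j (Nat.le_succ_of_le h) x⟩

/-- The `later` functor on objects. -/
def later (X : Tree) : Tree where
  obj
    | 0 => Unit
    | i + 1 => X.obj i
  res
    | 0 => fun _ => ()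
    | i + 1 => X.res i

/-- Global elements `1 → X`. -/
def Glob (X : Tree) : Type := {x : ∀ i, X.obj i // ∀ i, X.res i (x (i + 1)) = x i}

/-- The constant modality on objects: the constant object on the set of global elements. -/
def box (X : Tree) : Tree := const X.Glob

/-- A constant object, i.e. one whose restriction functions are bijections. -/
def IsConst (X : Tree) : Prop := ∀ i, Function.Bijective (X.res i)

open Classical in
/-- The fixed point of an operation on objects. The operations it is used for have exactly one
fixed point (`exists_fix` and `fix_unique`). -/
noncomputable def Fix (F : Tree → Tree) : Tree :=
  if h : ∃ X, F X = X then h.choose else const Unit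

/-! #### Agreement of objects below a stage, and existence and uniqueness of fixed points -/

/-- The part of an object below stage `m`. -/
structure Below (m : ℕ) where
  obj : ∀ j, j < m → Type
  res : ∀ j (h : j + 1 < m), obj (j + 1) h → obj j (Nat.lt_of_succ_lt h)

/-- The part of `X` below stage `m`. -/
def below (X : Tree) (m : ℕ) : Below m := ⟨fun j _ => X.obj j, fun j _ => X.res j⟩

theorem below_mono {X Y : Tree} {m n : ℕ} (h : m ≤ n) (e : X.below n = Y.below n) :
    X.below m = Y.below m :=
  congrArg (fun B : Below n => (⟨fun j hj => B.obj j (hj.trans_le h),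
    fun j hj => B.res j (hj.trans_le h)⟩ : Below m)) e

theorem below_zero (X Y : Tree) : X.below 0 = Y.below 0 := by
  have h1 : (X.below 0).obj = (Y.below 0).obj := by
    funext j hj; exact absurd hj (Nat.not_lt_zero j)
  have key : ∀ B C : Below 0, B.obj = C.obj → B = C := by
    rintro ⟨o, r⟩ ⟨o', r'⟩ h
    cases h
    congr
    funext j hj
    exact absurd hj (Nat.not_lt_zero _)
  exact key _ _ h1

theorem obj_eq_of_below {X Y : Tree} {m : ℕ} (e : X.below m = Y.below m) {j : ℕ} (h : j < m) :
    X.obj j = Y.obj j :=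
  congrArg (fun B : Below m => B.obj j h) e

theorem res_heq_of_below {X Y : Tree} {m : ℕ} (e : X.below m = Y.below m) {j : ℕ}
    (h : j + 1 < m) : HEq (X.res j) (Y.res j) := by
  have : ∀ B C : Below m, B = C → HEq (B.res j h) (C.res j h) := by
    rintro B _ rfl; rfl
  exact this _ _ e

theorem below_ext {X Y : Tree} {m : ℕ} (h1 : ∀ j, j < m → X.obj j = Y.obj j)
    (h2 : ∀ j, j + 1 < m → HEq (X.res j) (Y.res j)) : X.below m = Y.below m := by
  have key : ∀ B C : Below m, B.obj = C.obj → (∀ j h, HEq (B.res j h) (C.res j h)) → B = C := by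
    rintro ⟨o, r⟩ ⟨o', r'⟩ h h'
    cases h
    congr
    funext j hj
    exact eq_of_heq (h' j hj)
  exact key _ _ (by funext j hj; exact h1 j hj) (fun j hj => h2 j hj)

theorem ext_below {X Y : Tree} (h : ∀ m, X.below m = Y.below m) : X = Y := by
  obtain ⟨o, r⟩ := X
  obtain ⟨o', r'⟩ := Y
  have h1 : o = o' := by
    funext j; exact obj_eq_of_below (h (j + 1)) (Nat.lt_succ_self j)
  cases h1
  congr
  funext j
  exact eq_of_heq (res_heq_of_below (h (j + 2)) (Nat.lt_succ_self (j + 1)))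

theorem below_prod {X X' Y Y' : Tree} {m : ℕ} (h : X.below m = X'.below m)
    (k : Y.below m = Y'.below m) : (X.prod Y).below m = (X'.prod Y').below m :=
  congrArg₂ (fun P Q : Below m => (⟨fun j hj => P.obj j hj × Q.obj j hj,
    fun j hj p => (P.res j hj p.1, Q.res j hj p.2)⟩ : Below m)) h k

theorem below_sum {X X' Y Y' : Tree} {m : ℕ} (h : X.below m = X'.below m)
    (k : Y.below m = Y'.below m) : (X.sum Y).below m = (X'.sum Y').below m :=
  congrArg₂ (fun P Q : Below m => (⟨fun j hj => P.obj j hj ⊕ Q.obj j hj,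
    fun j hj => Sum.map (P.res j hj) (Q.res j hj)⟩ : Below m)) h k

theorem below_exp {X X' Y Y' : Tree} {m : ℕ} (h : X.below m = X'.below m)
    (k : Y.below m = Y'.below m) : (X.exp Y).below m = (X'.exp Y').below m :=
  congrArg₂ (fun P Q : Below m => (⟨fun i hi =>
      {f : ∀ j (h : j ≤ i), P.obj j (h.trans_lt hi) → Q.obj j (h.trans_lt hi) //
        ∀ j (h : j + 1 ≤ i) x, Q.res j (h.trans_lt hi) (f (j + 1) h x) =
          f j (Nat.le_of_succ_le h) (P.res j (h.trans_lt hi) x)},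
    fun _ _ f => ⟨fun j h => f.1 j (Nat.le_succ_of_le h),
      fun j h x => f.2 j (Nat.le_succ_of_le h) x⟩⟩ : Below m)) h k

theorem below_later {X X' : Tree} {m : ℕ} (h : X.below m = X'.below m) :
    X.later.below (m + 1) = X'.later.below (m + 1) := by
  apply below_ext
  · rintro (_ | j) hj
    · rfl
    · exact obj_eq_of_below h (Nat.lt_of_succ_lt_succ hj)
  · rintro (_ | j) hj
    · have h0 : X.obj 0 = X'.obj 0 := obj_eq_of_below h (Nat.lt_of_succ_lt_succ hj)
      change HEq (fun _ : X.obj 0 => ()) (fun _ : X'.obj 0 => ())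
      rw [h0]
    · exact res_heq_of_below h (Nat.lt_of_succ_lt_succ hj)

/-- An operation is contractive if the part of the result below stage `m + 1` is determined by the
part of the argument below stage `m`. -/
def Contractive (F : Tree → Tree) : Prop :=
  ∀ m X Y, X.below m = Y.below m → (F X).below (m + 1) = (F Y).below (m + 1)

theorem fix_unique {F : Tree → Tree} (hF : Contractive F) {X Y : Tree} (hX : F X = X)
    (hY : F Y = Y) : X = Y := by
  apply ext_below
  intro m
  induction m with
  | zero => exact below_zero X Y
  | succ m ih => rw [← hX, ← hY]; exact hF m X Y ih

theorem exists_fix {F : Tree → Tree} (hF : Contractive F) : ∃ X, F X = X := by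
  let S : ℕ → Tree := fun n => F^[n] (const Unit)
  have hS : ∀ n, S (n + 1) = F (S n) := fun n => Function.iterate_succ_apply' F n _
  have step : ∀ m, (S m).below m = (S (m + 1)).below m := by
    intro m
    induction m with
    | zero => exact below_zero _ _
    | succ m ih => rw [hS m, hS (m + 1)]; exact hF m _ _ ih
  have stable : ∀ m n, m ≤ n → (S m).below m = (S n).below m := by
    intro m n h
    induction n, h using Nat.le_induction with
    | base => rfl
    | succ n h ih => exact ih.trans (below_mono h (step n))
  have ho : ∀ i j, i < j → (S j).obj i = (S (i + 1)).obj i := fun i j h =>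
    (obj_eq_of_below (stable (i + 1) j h) (Nat.lt_succ_self i)).symm
  let X : Tree := ⟨fun i => (S (i + 1)).obj i,
    fun i x => cast (ho i (i + 2) (by omega)) ((S (i + 2)).res i x)⟩
  have hX : ∀ m, X.below m = (S m).below m := by
    intro m
    apply below_ext
    · intro j hj
      exact (ho j m hj).symm
    · intro j hj
      have h1 : HEq (X.res j) ((S (j + 2)).res j) := by
        have h2 := ho j (j + 2) (by omega)
        apply Function.hfunext rfl
        intro a b hab
        cases hab
        exact cast_heq _ _
      exact h1.trans (res_heq_of_below (stable (j + 2) m hj) (Nat.lt_succ_self (j + 1)))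
  refine ⟨X, ext_below ?_⟩
  intro m
  cases m with
  | zero => exact below_zero _ _
  | succ m =>
    rw [hF m X (S m) (hX m), ← hS m]
    exact (hX (m + 1)).symm

theorem fix_eq {F : Tree → Tree} (hF : Contractive F) : F (Fix F) = Fix F := by
  have h := exists_fix hF
  have e : Fix F = h.choose := dif_pos h
  rw [e]
  exact h.choose_spec

/-! #### Constant objects -/

theorem isConst_const (Z : Type) : (const Z).IsConst := fun _ => Function.bijective_id

theorem IsConst.prod {X Y : Tree} (hX : X.IsConst) (hY : Y.IsConst) : (X.prod Y).IsConst :=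
  fun i => Function.Bijective.prodMap (hX i) (hY i)

theorem IsConst.sum {X Y : Tree} (hX : X.IsConst) (hY : Y.IsConst) : (X.sum Y).IsConst :=
  fun i => (Equiv.sumCongr (Equiv.ofBijective _ (hX i)) (Equiv.ofBijective _ (hY i))).bijective

theorem IsConst.exp {X Y : Tree} (_ : X.IsConst) (hY : Y.IsConst) : (X.exp Y).IsConst := by
  intro i
  constructor
  · rintro ⟨f, hf⟩ ⟨g, hg⟩ e
    have e' : ∀ j (h : j ≤ i), f j (Nat.le_succ_of_le h) = g j (Nat.le_succ_of_le h) := fun j h =>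
      congrArg (fun u : (X.exp Y).obj i => u.1 j h) e
    apply Subtype.ext
    funext j h x
    rcases Nat.lt_or_eq_of_le h with h1 | rfl
    · exact congrFun (e' j (Nat.le_of_lt_succ h1)) x
    · apply (hY i).1
      exact (hf i h x).trans ((congrFun (e' i (le_refl i)) _).trans (hg i h x).symm)
  · rintro ⟨f, hf⟩
    have hex : ∀ x : X.obj (i + 1), ∃ y : Y.obj (i + 1), Y.res i y = f i (le_refl i) (X.res i x) :=
      fun x => (hY i).2 _
    choose top htop using hex
    refine ⟨⟨fun j h => if hj : j ≤ i then f j hj else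
      cast (by rw [show j = i + 1 by omega]) top, ?_⟩, ?_⟩
    · intro j h x
      have h0 : j ≤ i := by omega
      rcases Nat.lt_or_eq_of_le h0 with h1 | rfl
      · have h2 : j + 1 ≤ i := h1
        simp only [dif_pos h2, dif_pos h0]
        exact hf j h2 x
      · have h2 : ¬ j + 1 ≤ j := by omega
        simp only [dif_neg h2, dif_pos (le_refl j), cast_eq]
        exact htop x
    · apply Subtype.ext
      funext j h
      exact dif_pos h

theorem IsConst.exists_glob {X : Tree} (hX : X.IsConst) (i : ℕ) (x : X.obj i) :
    ∃ s : X.Glob, s.1 i = x := by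
  induction i with
  | zero =>
    choose up hup using fun i => (hX i).2
    exact ⟨⟨fun i => Nat.rec x (fun i y => up i y) i, fun i => hup i _⟩, rfl⟩
  | succ i ih =>
    obtain ⟨s, hs⟩ := ih (X.res i x)
    exact ⟨s, (hX i).1 ((s.2 i).trans hs)⟩

/-- The global element through an element of a constant object; it identifies the elements of a
constant object at different stages. -/
noncomputable def IsConst.glob {X : Tree} (hX : X.IsConst) (i : ℕ) (x : X.obj i) : X.Glob :=
  (hX.exists_glob i x).choose

theorem IsConst.glob_apply {X : Tree} (hX : X.IsConst) (i : ℕ) (x : X.obj i) :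
    (hX.glob i x).1 i = x :=
  (hX.exists_glob i x).choose_spec

theorem IsConst.glob_ext {X : Tree} (hX : X.IsConst) {s t : X.Glob} (i : ℕ) (h : s.1 i = t.1 i) :
    s = t := by
  have down : ∀ n (s t : X.Glob), s.1 n = t.1 n → s.1 0 = t.1 0 := by
    intro n s t
    induction n with
    | zero => exact id
    | succ n ih => intro h; apply ih; rw [← s.2 n, ← t.2 n, h]
  have h0 := down i s t h
  apply Subtype.ext
  funext j
  induction j with
  | zero => exact h0
  | succ j ih => apply (hX j).1; rw [s.2 j, t.2 j, ih]

theorem IsConst.glob_res {X : Tree} (hX : X.IsConst) (i : ℕ) (x : X.obj (i + 1)) :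
    hX.glob i (X.res i x) = hX.glob (i + 1) x := by
  apply hX.glob_ext i
  rw [glob_apply, ← (hX.glob (i + 1) x).2 i, glob_apply]

end Tree

/-! ### Types -/

/-- Types with type variables among `0, …, n - 1` (de Bruijn indices). The argument of `box` is
required to be closed. -/
inductive Ty : ℕ → Type
  | var {n : ℕ} (i : Fin n) : Ty n
  | nat {n : ℕ} : Ty n
  | one {n : ℕ} : Ty n
  | prod {n : ℕ} (A B : Ty n) : Ty n
  | zero {n : ℕ} : Ty n
  | sum {n : ℕ} (A B : Ty n) : Ty n
  | arr {n : ℕ} (A B : Ty n) : Ty n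
  | mu {n : ℕ} (A : Ty (n + 1)) : Ty n
  | later {n : ℕ} (A : Ty n) : Ty n
  | box {n : ℕ} (A : Ty 0) : Ty n

namespace Ty

/-- All occurrences of the variable `i` are beneath an occurrence of `later`. -/
def Guarded : {n : ℕ} → Fin n → Ty n → Prop
  | _, i, .var j => i ≠ j
  | _, _, .nat => True
  | _, _, .one => True
  | _, i, .prod A B => Guarded i A ∧ Guarded i B
  | _, _, .zero => True
  | _, i, .sum A B => Guarded i A ∧ Guarded i B
  | _, i, .arr A B => Guarded i A ∧ Guarded i B
  | _, i, .mu A => Guarded i.succ A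
  | _, _, .later _ => True
  | _, _, .box _ => True

/-- Well-formed types: each `mu` binds a guarded variable. -/
def WF : {n : ℕ} → Ty n → Prop
  | _, .var _ => True
  | _, .nat => True
  | _, .one => True
  | _, .prod A B => WF A ∧ WF B
  | _, .zero => True
  | _, .sum A B => WF A ∧ WF B
  | _, .arr A B => WF A ∧ WF B
  | _, .mu A => Guarded 0 A ∧ WF A
  | _, .later A => WF A
  | _, .box A => WF A

/-- Constant types: all occurrences of `later` are beneath an occurrence of `box`. -/
def Constant : {n : ℕ} → Ty n → Prop
  | _, .var _ => True
  | _, .nat => True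
  | _, .one => True
  | _, .prod A B => Constant A ∧ Constant B
  | _, .zero => True
  | _, .sum A B => Constant A ∧ Constant B
  | _, .arr A B => Constant A ∧ Constant B
  | _, .mu A => Constant A
  | _, .later _ => False
  | _, .box _ => True

/-- Renaming of type variables. -/
def rename : {n : ℕ} → Ty n → {m : ℕ} → (Fin n → Fin m) → Ty m
  | _, .var i, _, r => .var (r i)
  | _, .nat, _, _ => .nat
  | _, .one, _, _ => .one
  | _, .prod A B, _, r => .prod (A.rename r) (B.rename r)
  | _, .zero, _, _ => .zero
  | _, .sum A B, _, r => .sum (A.rename r) (B.rename r)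
  | _, .arr A B, _, r => .arr (A.rename r) (B.rename r)
  | _, .mu A, m, r =>
    .mu (A.rename (Fin.cons (α := fun _ => Fin (m + 1)) 0 fun i => (r i).succ))
  | _, .later A, _, r => .later (A.rename r)
  | _, .box A, _, _ => .box A

/-- Simultaneous substitution for type variables. -/
def subst : {n : ℕ} → Ty n → {m : ℕ} → (Fin n → Ty m) → Ty m
  | _, .var i, _, σ => σ i
  | _, .nat, _, _ => .nat
  | _, .one, _, _ => .one
  | _, .prod A B, _, σ => .prod (A.subst σ) (B.subst σ)
  | _, .zero, _, _ => .zero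
  | _, .sum A B, _, σ => .sum (A.subst σ) (B.subst σ)
  | _, .arr A B, _, σ => .arr (A.subst σ) (B.subst σ)
  | _, .mu A, m, σ =>
    .mu (A.subst (Fin.cons (α := fun _ => Ty (m + 1)) (.var 0) fun i => (σ i).rename Fin.succ))
  | _, .later A, _, σ => .later (A.subst σ)
  | _, .box A, _, _ => .box A

/-- `A[B/α]` for the only variable `α` of `A`. -/
def inst (A : Ty 1) (B : Ty 0) : Ty 0 := A.subst fun _ => B

/-- A closed type, regarded as a type with `n` variables. -/
def weaken {n : ℕ} (A : Ty 0) : Ty n := A.rename Fin.elim0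

theorem subst_var {n : ℕ} (A : Ty n) : A.subst .var = A := by
  induction A with
  | mu A ih =>
    simp only [subst, mu.injEq]
    conv_rhs => rw [← ih]
    congr 1
    funext i
    refine Fin.cases rfl (fun j => rfl) i
  | _ => simp_all [subst]

theorem subst_rename {n : ℕ} (A : Ty n) : ∀ {m l : ℕ} (r : Fin n → Fin m) (σ : Fin m → Ty l),
    (A.rename r).subst σ = A.subst fun i => σ (r i) := by
  induction A with
  | mu A ih =>
    intro m l r σ
    simp only [rename, subst, mu.injEq, ih]
    congr 1
    funext i
    refine Fin.cases rfl (fun j => rfl) i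
  | _ => simp_all [rename, subst]

theorem inst_weaken (A B : Ty 0) : A.weaken.inst B = A := by
  unfold weaken inst
  rw [subst_rename]
  conv_rhs => rw [← subst_var A]
  congr 1
  funext i
  exact i.elim0

theorem guarded_rename {n : ℕ} (A : Ty n) : ∀ {m : ℕ} (r : Fin n → Fin m) (i : Fin m),
    (∀ j, r j = i → A.Guarded j) → (A.rename r).Guarded i := by
  induction A with
  | var j => intro m r i h e; exact h j e.symm rfl
  | prod A B ihA ihB => exact fun r i h => ⟨ihA r i fun j e => (h j e).1, ihB r i fun j e => (h j e).2⟩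
  | sum A B ihA ihB => exact fun r i h => ⟨ihA r i fun j e => (h j e).1, ihB r i fun j e => (h j e).2⟩
  | arr A B ihA ihB => exact fun r i h => ⟨ihA r i fun j e => (h j e).1, ihB r i fun j e => (h j e).2⟩
  | mu A ih =>
    intro m r i h
    refine ih _ _ fun j => ?_
    refine Fin.cases (fun e => ?_) (fun j e => ?_) j
    · exact absurd e.symm (Fin.succ_ne_zero i)
    · exact h j (Fin.succ_injective _ e)
  | _ => simp [rename, Guarded]

theorem wf_rename {n : ℕ} (A : Ty n) : ∀ {m : ℕ} (r : Fin n → Fin m),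
    A.WF → (A.rename r).WF := by
  induction A with
  | prod A B ihA ihB => exact fun r h => ⟨ihA r h.1, ihB r h.2⟩
  | sum A B ihA ihB => exact fun r h => ⟨ihA r h.1, ihB r h.2⟩
  | arr A B ihA ihB => exact fun r h => ⟨ihA r h.1, ihB r h.2⟩
  | mu A ih =>
    intro m r h
    refine ⟨guarded_rename A _ _ fun j => ?_, ih _ h.2⟩
    refine Fin.cases (fun _ => h.1) (fun j e => ?_) j
    exact absurd e (Fin.succ_ne_zero _)
  | later A ih => exact fun r h => ih r h
  | box A ih => exact fun r h => h
  | _ => simp [rename, WF]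

/-- Denotation of a type, given objects for its type variables. -/
noncomputable def den : {n : ℕ} → Ty n → (Fin n → Tree) → Tree
  | _, .var i, ρ => ρ i
  | _, .nat, _ => Tree.const ℕ
  | _, .one, _ => Tree.const Unit
  | _, .prod A B, ρ => (A.den ρ).prod (B.den ρ)
  | _, .zero, _ => Tree.const Empty
  | _, .sum A B, ρ => (A.den ρ).sum (B.den ρ)
  | _, .arr A B, ρ => (A.den ρ).exp (B.den ρ)
  | _, .mu A, ρ => Tree.Fix fun X => A.den (Fin.cons (α := fun _ => Tree) X ρ)
  | _, .later A, ρ => (A.den ρ).later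
  | _, .box A, _ => (A.den Fin.elim0).box

/-- Denotation of a closed type. -/
noncomputable def D (A : Ty 0) : Tree := A.den Fin.elim0

theorem den_rename {n : ℕ} (A : Ty n) : ∀ {m : ℕ} (r : Fin n → Fin m) (ρ : Fin m → Tree),
    (A.rename r).den ρ = A.den fun i => ρ (r i) := by
  induction A with
  | mu A ih =>
    intro m r ρ
    simp only [rename, den, ih]
    congr 1
    funext X
    congr 1
    funext i
    refine Fin.cases rfl (fun j => rfl) i
  | _ => simp_all [rename, den]

theorem den_subst {n : ℕ} (A : Ty n) : ∀ {m : ℕ} (σ : Fin n → Ty m) (ρ : Fin m → Tree),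
    (A.subst σ).den ρ = A.den fun i => (σ i).den ρ := by
  induction A with
  | mu A ih =>
    intro m σ ρ
    simp only [subst, den, ih]
    congr 1
    funext X
    congr 1
    funext i
    refine Fin.cases rfl (fun j => ?_) i
    simp only [Fin.cons_succ, den_rename]
  | _ => simp_all [subst, den]

/-- Below stage `m + 1`, the denotation depends on the guarded variables below stage `m` only. -/
theorem den_below {n : ℕ} (A : Ty n) : A.WF → ∀ (m : ℕ) (ρ ρ' : Fin n → Tree),
    (∀ i, (ρ i).below m = (ρ' i).below m) →
    (∀ i, ¬ A.Guarded i → (ρ i).below (m + 1) = (ρ' i).below (m + 1)) →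
    (A.den ρ).below (m + 1) = (A.den ρ').below (m + 1) := by
  induction A with
  | var i => exact fun _ m ρ ρ' _ h => h i (fun h => h rfl)
  | prod A B ihA ihB =>
    exact fun w m ρ ρ' h h' => Tree.below_prod
      (ihA w.1 m ρ ρ' h fun i g => h' i fun k => g k.1)
      (ihB w.2 m ρ ρ' h fun i g => h' i fun k => g k.2)
  | sum A B ihA ihB =>
    exact fun w m ρ ρ' h h' => Tree.below_sum
      (ihA w.1 m ρ ρ' h fun i g => h' i fun k => g k.1)
      (ihB w.2 m ρ ρ' h fun i g => h' i fun k => g k.2)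
  | arr A B ihA ihB =>
    exact fun w m ρ ρ' h h' => Tree.below_exp
      (ihA w.1 m ρ ρ' h fun i g => h' i fun k => g k.1)
      (ihB w.2 m ρ ρ' h fun i g => h' i fun k => g k.2)
  | later A ih =>
    intro w m ρ ρ' h _
    apply Tree.below_later
    cases m with
    | zero => exact Tree.below_zero _ _
    | succ m =>
      exact ih w m ρ ρ' (fun i => Tree.below_mono (Nat.le_succ m) (h i)) (fun i _ => h i)
  | mu A ih =>
    intro w m ρ ρ' h h'
    have con : ∀ ρ, Tree.Contractive fun X => A.den (Fin.cons (α := fun _ => Tree) X ρ) := by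
      intro ρ l X Y e
      refine ih w.2 l _ _ (fun i => ?_) (fun i => ?_)
      · exact Fin.cases e (fun j => rfl) i
      · exact Fin.cases (fun g => absurd w.1 g) (fun j _ => rfl) i
    have key : ∀ l, l ≤ m + 1 →
        ((Ty.mu A).den ρ).below l = ((Ty.mu A).den ρ').below l := by
      intro l
      induction l with
      | zero => exact fun _ => Tree.below_zero _ _
      | succ l ihl =>
        intro hl
        have e1 := Tree.fix_eq (con ρ)
        have e2 := Tree.fix_eq (con ρ')
        change Tree.below (Tree.Fix _) _ = Tree.below (Tree.Fix _) _
        rw [← e1, ← e2]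
        refine ih w.2 l _ _ (fun i => ?_) (fun i => ?_)
        · exact Fin.cases (ihl (by omega)) (fun j => Tree.below_mono (by omega) (h j)) i
        · exact Fin.cases (fun g => absurd w.1 g)
            (fun j g => Tree.below_mono hl (h' j g)) i
    exact key (m + 1) le_rfl
  | _ => intros; rfl

theorem contractive_of_guarded {n : ℕ} {A : Ty (n + 1)} (hA : (mu A).WF) (ρ : Fin n → Tree) :
    Tree.Contractive fun X => A.den (Fin.cons (α := fun _ => Tree) X ρ) := by
  intro l X Y e
  refine den_below A hA.2 l _ _ (fun i => ?_) (fun i => ?_)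
  · exact Fin.cases e (fun j => rfl) i
  · exact Fin.cases (fun g => absurd hA.1 g) (fun j _ => rfl) i

/-- A recursive type has the same denotation as its unfolding. -/
theorem D_inst {A : Ty 1} (hA : (mu A).WF) : (A.inst (mu A)).D = (mu A).D := by
  unfold D inst
  rw [den_subst]
  have e := Tree.fix_eq (contractive_of_guarded hA Fin.elim0)
  refine Eq.trans ?_ e
  congr 1
  funext i
  refine Fin.cases rfl (fun j => j.elim0) i

theorem den_isConst {n : ℕ} (A : Ty n) : A.WF → A.Constant → ∀ ρ : Fin n → Tree,
    (∀ i, ¬ A.Guarded i → (ρ i).IsConst) → (A.den ρ).IsConst := by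
  induction A with
  | var i => exact fun _ _ ρ h => h i (fun h => h rfl)
  | nat => exact fun _ _ _ _ => Tree.isConst_const _
  | one => exact fun _ _ _ _ => Tree.isConst_const _
  | zero => exact fun _ _ _ _ => Tree.isConst_const _
  | box A _ => exact fun _ _ _ _ => Tree.isConst_const _
  | later A _ => exact fun _ c => c.elim
  | prod A B ihA ihB =>
    exact fun w c ρ h => (ihA w.1 c.1 ρ fun i g => h i fun k => g k.1).prod
      (ihB w.2 c.2 ρ fun i g => h i fun k => g k.2)
  | sum A B ihA ihB =>
    exact fun w c ρ h => (ihA w.1 c.1 ρ fun i g => h i fun k => g k.1).sum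
      (ihB w.2 c.2 ρ fun i g => h i fun k => g k.2)
  | arr A B ihA ihB =>
    exact fun w c ρ h => (ihA w.1 c.1 ρ fun i g => h i fun k => g k.1).exp
      (ihB w.2 c.2 ρ fun i g => h i fun k => g k.2)
  | mu A ih =>
    intro w c ρ h
    change (Tree.Fix _).IsConst
    rw [← Tree.fix_eq (contractive_of_guarded w ρ)]
    refine ih w.2 c _ fun i => ?_
    exact Fin.cases (fun g => absurd w.1 g) (fun j g => h j g) i

/-- Constant types denote constant objects. -/
theorem D_isConst {A : Ty 0} (w : A.WF) (c : A.Constant) : A.D.IsConst :=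
  den_isConst A w c _ fun i => i.elim0

end Ty

/-! ### Terms -/

/-- `Var Γ A`: the variables of type `A` in the typing context `Γ`. -/
inductive Var : List (Ty 0) → Ty 0 → Type
  | z {Γ : List (Ty 0)} {A : Ty 0} : Var (A :: Γ) A
  | s {Γ : List (Ty 0)} {A B : Ty 0} (x : Var Γ A) : Var (B :: Γ) A

/-- `Tm K Γ A`: the typed terms `Γ ⊢ t : A` of the guarded lambda-calculus, including the term-former
`boxSum`. The additional atoms `K Γ A` of type `A` in context `Γ` are used for the function symbols of
a signature and for the holes of contexts; `K` is empty for the calculus itself. In `prev`, `box` and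
`boxSum`, the term `t` lives in a context `Δ` of constant types, and `σ` is the explicit substitution
attached to the term-former. -/
inductive Tm (K : List (Ty 0) → Ty 0 → Type) : List (Ty 0) → Ty 0 → Type
  | atom {Γ : List (Ty 0)} {A : Ty 0} (c : K Γ A) : Tm K Γ A
  | var {Γ : List (Ty 0)} {A : Ty 0} (x : Var Γ A) : Tm K Γ A
  | zero {Γ : List (Ty 0)} : Tm K Γ .nat
  | succ {Γ : List (Ty 0)} (t : Tm K Γ .nat) : Tm K Γ .nat
  | unit {Γ : List (Ty 0)} : Tm K Γ .one
  | pair {Γ : List (Ty 0)} {A B : Ty 0} (t : Tm K Γ A) (u : Tm K Γ B) : Tm K Γ (.prod A B)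
  | fst {Γ : List (Ty 0)} {A B : Ty 0} (t : Tm K Γ (.prod A B)) : Tm K Γ A
  | snd {Γ : List (Ty 0)} {A B : Ty 0} (t : Tm K Γ (.prod A B)) : Tm K Γ B
  | abort {Γ : List (Ty 0)} {A : Ty 0} (hA : A.WF) (t : Tm K Γ .zero) : Tm K Γ A
  | inl {Γ : List (Ty 0)} {A B : Ty 0} (hB : B.WF) (t : Tm K Γ A) : Tm K Γ (.sum A B)
  | inr {Γ : List (Ty 0)} {A B : Ty 0} (hA : A.WF) (t : Tm K Γ B) : Tm K Γ (.sum A B)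
  | case {Γ : List (Ty 0)} {A B C : Ty 0} (t : Tm K Γ (.sum A B)) (u : Tm K (A :: Γ) C)
      (v : Tm K (B :: Γ) C) : Tm K Γ C
  | lam {Γ : List (Ty 0)} {A B : Ty 0} (hA : A.WF) (t : Tm K (A :: Γ) B) : Tm K Γ (.arr A B)
  | app {Γ : List (Ty 0)} {A B : Ty 0} (t : Tm K Γ (.arr A B)) (u : Tm K Γ A) : Tm K Γ B
  | fold {Γ : List (Ty 0)} {A : Ty 1} {B : Ty 0} (hA : (Ty.mu A).WF) (hB : B = A.inst (.mu A))
      (t : Tm K Γ B) : Tm K Γ (.mu A)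
  | unfold {Γ : List (Ty 0)} {A : Ty 1} {B : Ty 0} (hA : (Ty.mu A).WF) (hB : B = A.inst (.mu A))
      (t : Tm K Γ (.mu A)) : Tm K Γ B
  | next {Γ : List (Ty 0)} {A : Ty 0} (t : Tm K Γ A) : Tm K Γ (.later A)
  | prev {Γ Δ : List (Ty 0)} {A : Ty 0} (hΔ : ∀ B, Var Δ B → B.WF ∧ B.Constant)
      (t : Tm K Δ (.later A)) (σ : ∀ B, Var Δ B → Tm K Γ B) : Tm K Γ A
  | ap {Γ : List (Ty 0)} {A B : Ty 0} (t : Tm K Γ (.later (.arr A B))) (u : Tm K Γ (.later A)) :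
      Tm K Γ (.later B)
  | box {Γ Δ : List (Ty 0)} {A : Ty 0} (hΔ : ∀ B, Var Δ B → B.WF ∧ B.Constant)
      (t : Tm K Δ A) (σ : ∀ B, Var Δ B → Tm K Γ B) : Tm K Γ (.box A)
  | unbox {Γ : List (Ty 0)} {A : Ty 0} (t : Tm K Γ (.box A)) : Tm K Γ A
  | boxSum {Γ Δ : List (Ty 0)} {A B : Ty 0} (hΔ : ∀ C, Var Δ C → C.WF ∧ C.Constant)
      (t : Tm K Δ (.sum A B)) (σ : ∀ C, Var Δ C → Tm K Γ C) : Tm K Γ (.sum (.box A) (.box B))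

/-- Terms of the calculus extended with closed constants `S A` of type `A`. -/
abbrev Term (S : Ty 0 → Type) : List (Ty 0) → Ty 0 → Type := Tm fun _ A => S A

/-- Terms of the calculus itself. -/
abbrev Pure : List (Ty 0) → Ty 0 → Type := Term fun _ => Empty

/-- Lifting of a renaming under a binder. -/
def Var.lift {Γ Δ : List (Ty 0)} (r : ∀ B, Var Γ B → Var Δ B) (A : Ty 0) :
    ∀ B, Var (A :: Γ) B → Var (A :: Δ) B
  | _, .z => .z
  | _, .s x => .s (r _ x)

namespace Tm

/-- Renaming of variables. -/
def rename {S : Ty 0 → Type} : {Γ : List (Ty 0)} → {A : Ty 0} → Term S Γ A →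
    {Δ : List (Ty 0)} → (∀ B, Var Γ B → Var Δ B) → Term S Δ A
  | _, _, .atom c, _, _ => .atom c
  | _, _, .var x, _, r => .var (r _ x)
  | _, _, .zero, _, _ => .zero
  | _, _, .succ t, _, r => .succ (t.rename r)
  | _, _, .unit, _, _ => .unit
  | _, _, .pair t u, _, r => .pair (t.rename r) (u.rename r)
  | _, _, .fst t, _, r => .fst (t.rename r)
  | _, _, .snd t, _, r => .snd (t.rename r)
  | _, _, .abort h t, _, r => .abort h (t.rename r)
  | _, _, .inl h t, _, r => .inl h (t.rename r)
  | _, _, .inr h t, _, r => .inr h (t.rename r)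
  | _, _, .case t u v, _, r =>
    .case (t.rename r) (u.rename (Var.lift r _)) (v.rename (Var.lift r _))
  | _, _, .lam h t, _, r => .lam h (t.rename (Var.lift r _))
  | _, _, .app t u, _, r => .app (t.rename r) (u.rename r)
  | _, _, .fold h h' t, _, r => .fold h h' (t.rename r)
  | _, _, .unfold h h' t, _, r => .unfold h h' (t.rename r)
  | _, _, .next t, _, r => .next (t.rename r)
  | _, _, .prev h t σ, _, r => .prev h t fun B x => (σ B x).rename r
  | _, _, .ap t u, _, r => .ap (t.rename r) (u.rename r)
  | _, _, .box h t σ, _, r => .box h t fun B x => (σ B x).rename r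
  | _, _, .unbox t, _, r => .unbox (t.rename r)
  | _, _, .boxSum h t σ, _, r => .boxSum h t fun B x => (σ B x).rename r

/-- Lifting of a substitution under a binder. -/
def liftSubst {S : Ty 0 → Type} {Γ Δ : List (Ty 0)} (τ : ∀ B, Var Γ B → Term S Δ B) (A : Ty 0) :
    ∀ B, Var (A :: Γ) B → Term S (A :: Δ) B
  | _, .z => .var .z
  | _, .s x => (τ _ x).rename fun _ => .s

/-- Simultaneous substitution `t[u⃗/x⃗]`. -/
def subst {S : Ty 0 → Type} : {Γ : List (Ty 0)} → {A : Ty 0} → Term S Γ A →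
    {Δ : List (Ty 0)} → (∀ B, Var Γ B → Term S Δ B) → Term S Δ A
  | _, _, .atom c, _, _ => .atom c
  | _, _, .var x, _, τ => τ _ x
  | _, _, .zero, _, _ => .zero
  | _, _, .succ t, _, τ => .succ (t.subst τ)
  | _, _, .unit, _, _ => .unit
  | _, _, .pair t u, _, τ => .pair (t.subst τ) (u.subst τ)
  | _, _, .fst t, _, τ => .fst (t.subst τ)
  | _, _, .snd t, _, τ => .snd (t.subst τ)
  | _, _, .abort h t, _, τ => .abort h (t.subst τ)
  | _, _, .inl h t, _, τ => .inl h (t.subst τ)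
  | _, _, .inr h t, _, τ => .inr h (t.subst τ)
  | _, _, .case t u v, _, τ =>
    .case (t.subst τ) (u.subst (liftSubst τ _)) (v.subst (liftSubst τ _))
  | _, _, .lam h t, _, τ => .lam h (t.subst (liftSubst τ _))
  | _, _, .app t u, _, τ => .app (t.subst τ) (u.subst τ)
  | _, _, .fold h h' t, _, τ => .fold h h' (t.subst τ)
  | _, _, .unfold h h' t, _, τ => .unfold h h' (t.subst τ)
  | _, _, .next t, _, τ => .next (t.subst τ)
  | _, _, .prev h t σ, _, τ => .prev h t fun B x => (σ B x).subst τ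
  | _, _, .ap t u, _, τ => .ap (t.subst τ) (u.subst τ)
  | _, _, .box h t σ, _, τ => .box h t fun B x => (σ B x).subst τ
  | _, _, .unbox t, _, τ => .unbox (t.subst τ)
  | _, _, .boxSum h t σ, _, τ => .boxSum h t fun B x => (σ B x).subst τ

/-- The substitution of `u` for the last variable. -/
def single {S : Ty 0 → Type} {Γ : List (Ty 0)} {A : Ty 0} (u : Term S Γ A) :
    ∀ B, Var (A :: Γ) B → Term S Γ B
  | _, .z => u
  | _, .s x => .var x

/-- Replacement of atoms by terms, without renaming of variables. -/
def bindAtoms {K K' : List (Ty 0) → Ty 0 → Type} (φ : ∀ Γ A, K Γ A → Tm K' Γ A) :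
    {Γ : List (Ty 0)} → {A : Ty 0} → Tm K Γ A → Tm K' Γ A
  | _, _, .atom c => φ _ _ c
  | _, _, .var x => .var x
  | _, _, .zero => .zero
  | _, _, .succ t => .succ (t.bindAtoms φ)
  | _, _, .unit => .unit
  | _, _, .pair t u => .pair (t.bindAtoms φ) (u.bindAtoms φ)
  | _, _, .fst t => .fst (t.bindAtoms φ)
  | _, _, .snd t => .snd (t.bindAtoms φ)
  | _, _, .abort h t => .abort h (t.bindAtoms φ)
  | _, _, .inl h t => .inl h (t.bindAtoms φ)
  | _, _, .inr h t => .inr h (t.bindAtoms φ)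
  | _, _, .case t u v => .case (t.bindAtoms φ) (u.bindAtoms φ) (v.bindAtoms φ)
  | _, _, .lam h t => .lam h (t.bindAtoms φ)
  | _, _, .app t u => .app (t.bindAtoms φ) (u.bindAtoms φ)
  | _, _, .fold h h' t => .fold h h' (t.bindAtoms φ)
  | _, _, .unfold h h' t => .unfold h h' (t.bindAtoms φ)
  | _, _, .next t => .next (t.bindAtoms φ)
  | _, _, .prev h t σ => .prev h (t.bindAtoms φ) fun B x => (σ B x).bindAtoms φ
  | _, _, .ap t u => .ap (t.bindAtoms φ) (u.bindAtoms φ)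
  | _, _, .box h t σ => .box h (t.bindAtoms φ) fun B x => (σ B x).bindAtoms φ
  | _, _, .unbox t => .unbox (t.bindAtoms φ)
  | _, _, .boxSum h t σ => .boxSum h (t.bindAtoms φ) fun B x => (σ B x).bindAtoms φ

end Tm

/-! ### Operational semantics and contextual equivalence -/

/-- The empty context consists of constant types. -/
theorem nilConst : ∀ B, Var [] B → B.WF ∧ B.Constant := fun _ x => nomatch x

/-- The empty explicit substitution. -/
def nilSubst {K : List (Ty 0) → Ty 0 → Type} {Γ : List (Ty 0)} : ∀ B, Var [] B → Tm K Γ B :=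
  fun _ x => nomatch x

/-- Closed values. -/
inductive IsValue : {A : Ty 0} → Pure [] A → Prop
  | zero : IsValue .zero
  | succ {t : Pure [] .nat} : IsValue t → IsValue (.succ t)
  | unit : IsValue .unit
  | pair {A B : Ty 0} (t : Pure [] A) (u : Pure [] B) : IsValue (.pair t u)
  | inl {A B : Ty 0} (hB : B.WF) (t : Pure [] A) : IsValue (.inl hB t)
  | inr {A B : Ty 0} (hA : A.WF) (t : Pure [] B) : IsValue (.inr hA t)
  | lam {A B : Ty 0} (hA : A.WF) (t : Pure [A] B) : IsValue (.lam hA t)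
  | fold {A : Ty 1} {B : Ty 0} (hA : (Ty.mu A).WF) (hB : B = A.inst (.mu A)) (t : Pure [] B) :
      IsValue (.fold hA hB t)
  | next {A : Ty 0} (t : Pure [] A) : IsValue (.next t)
  | box {Δ : List (Ty 0)} {A : Ty 0} (hΔ : ∀ B, Var Δ B → B.WF ∧ B.Constant) (t : Pure Δ A)
      (σ : ∀ B, Var Δ B → Pure [] B) : IsValue (.box hΔ t σ)

/-- Call-by-name reduction of closed terms: the reduction rules, followed by one rule for each form
of evaluation context. -/
inductive Step : {A : Ty 0} → Pure [] A → Pure [] A → Prop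
  | fst_pair {A B : Ty 0} (t : Pure [] A) (u : Pure [] B) : Step (.fst (.pair t u)) t
  | snd_pair {A B : Ty 0} (t : Pure [] A) (u : Pure [] B) : Step (.snd (.pair t u)) u
  | case_inl {A B C : Ty 0} (hB : B.WF) (t : Pure [] A) (u : Pure [A] C) (v : Pure [B] C) :
      Step (.case (.inl hB t) u v) (u.subst (Tm.single t))
  | case_inr {A B C : Ty 0} (hA : A.WF) (t : Pure [] B) (u : Pure [A] C) (v : Pure [B] C) :
      Step (.case (.inr hA t) u v) (v.subst (Tm.single t))
  | beta {A B : Ty 0} (hA : A.WF) (t : Pure [A] B) (u : Pure [] A) :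
      Step (.app (.lam hA t) u) (t.subst (Tm.single u))
  | unfold_fold {A : Ty 1} {B : Ty 0} (hA : (Ty.mu A).WF) (hB : B = A.inst (.mu A))
      (t : Pure [] B) : Step (.unfold hA hB (.fold hA hB t)) t
  | prev_subst {Δ : List (Ty 0)} {A : Ty 0} (hΔ : ∀ B, Var Δ B → B.WF ∧ B.Constant)
      (t : Pure Δ (.later A)) (σ : ∀ B, Var Δ B → Pure [] B) (hne : Δ ≠ []) :
      Step (.prev hΔ t σ) (.prev nilConst (t.subst σ) nilSubst)
  | prev_next {A : Ty 0} (t : Pure [] A) : Step (.prev nilConst (.next t) nilSubst) t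
  | ap_next {A B : Ty 0} (t : Pure [] (.arr A B)) (u : Pure [] A) :
      Step (.ap (.next t) (.next u)) (.next (.app t u))
  | unbox_box {Δ : List (Ty 0)} {A : Ty 0} (hΔ : ∀ B, Var Δ B → B.WF ∧ B.Constant)
      (t : Pure Δ A) (σ : ∀ B, Var Δ B → Pure [] B) : Step (.unbox (.box hΔ t σ)) (t.subst σ)
  | boxSum_subst {Δ : List (Ty 0)} {A B : Ty 0} (hΔ : ∀ C, Var Δ C → C.WF ∧ C.Constant)
      (t : Pure Δ (.sum A B)) (σ : ∀ C, Var Δ C → Pure [] C) (hne : Δ ≠ []) :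
      Step (.boxSum hΔ t σ) (.boxSum nilConst (t.subst σ) nilSubst)
  | boxSum_inl {A B : Ty 0} (hB : B.WF) (hB' : (Ty.box B : Ty 0).WF) (t : Pure [] A) :
      Step (.boxSum nilConst (.inl hB t) nilSubst) (.inl hB' (.box nilConst t nilSubst))
  | boxSum_inr {A B : Ty 0} (hA : A.WF) (hA' : (Ty.box A : Ty 0).WF) (t : Pure [] B) :
      Step (.boxSum nilConst (.inr hA t) nilSubst) (.inr hA' (.box nilConst t nilSubst))
  | succ {t t' : Pure [] .nat} : Step t t' → Step (.succ t) (.succ t')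
  | fst {A B : Ty 0} {t t' : Pure [] (.prod A B)} : Step t t' → Step (.fst t) (.fst t')
  | snd {A B : Ty 0} {t t' : Pure [] (.prod A B)} : Step t t' → Step (.snd t) (.snd t')
  | case {A B C : Ty 0} {t t' : Pure [] (.sum A B)} (u : Pure [A] C) (v : Pure [B] C) :
      Step t t' → Step (.case t u v) (.case t' u v)
  | app {A B : Ty 0} {t t' : Pure [] (.arr A B)} (u : Pure [] A) :
      Step t t' → Step (.app t u) (.app t' u)
  | unfold {A : Ty 1} {B : Ty 0} (hA : (Ty.mu A).WF) (hB : B = A.inst (.mu A))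
      {t t' : Pure [] (.mu A)} : Step t t' → Step (.unfold hA hB t) (.unfold hA hB t')
  | prev {A : Ty 0} {t t' : Pure [] (.later A)} :
      Step t t' → Step (.prev nilConst t nilSubst) (.prev nilConst t' nilSubst)
  | ap_left {A B : Ty 0} {t t' : Pure [] (.later (.arr A B))} (u : Pure [] (.later A)) :
      Step t t' → Step (.ap t u) (.ap t' u)
  | ap_right {A B : Ty 0} {v : Pure [] (.later (.arr A B))} (hv : IsValue v)
      {u u' : Pure [] (.later A)} : Step u u' → Step (.ap v u) (.ap v u')
  | unbox {A : Ty 0} {t t' : Pure [] (.box A)} : Step t t' → Step (.unbox t) (.unbox t')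
  | boxSum {A B : Ty 0} {t t' : Pure [] (.sum A B)} :
      Step t t' → Step (.boxSum nilConst t nilSubst) (.boxSum nilConst t' nilSubst)

/-- A hole, to be filled by terms of type `A₀` in context `Γ₀`. -/
inductive Hole (Γ₀ : List (Ty 0)) (A₀ : Ty 0) : List (Ty 0) → Ty 0 → Type
  | hole : Hole Γ₀ A₀ Γ₀ A₀

/-- Typed contexts with typed holes; filling a hole may capture variables. -/
abbrev Ctx (Γ₀ : List (Ty 0)) (A₀ : Ty 0) : List (Ty 0) → Ty 0 → Type := Tm (Hole Γ₀ A₀)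

/-- `C[t]`. -/
def Ctx.fill {Γ₀ Γ : List (Ty 0)} {A₀ A : Ty 0} (C : Ctx Γ₀ A₀ Γ A) (t : Pure Γ₀ A₀) : Pure Γ A :=
  C.bindAtoms fun _ _ c => match c with
    | .hole => t

/-- Contextual equivalence: for all closing contexts `C` of type `nat`, the terms `C[t]` and `C[u]`
reduce to the same value. -/
def CtxEq {Γ : List (Ty 0)} {A : Ty 0} (t u : Pure Γ A) : Prop :=
  ∀ C : Ctx Γ A [] .nat, ∃ v : Pure [] .nat, IsValue v ∧
    Relation.ReflTransGen Step (C.fill t) v ∧ Relation.ReflTransGen Step (C.fill u) v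

/-! ### Denotational semantics -/

namespace Tree

namespace Hom

/-- Composition. -/
def comp {X Y Z : Tree} (g : Y.Hom Z) (f : X.Hom Y) : X.Hom Z :=
  ⟨fun i x => g.app i (f.app i x), fun i x => by rw [g.naturality, f.naturality]⟩

/-- The arrow given by an equality of objects. -/
def ofEq {X Y : Tree} (h : X = Y) : X.Hom Y :=
  ⟨fun i x => h ▸ x, fun i x => by cases h; rfl⟩

/-- The arrow into a product. -/
def pair {X Y Z : Tree} (f : X.Hom Y) (g : X.Hom Z) : X.Hom (Y.prod Z) :=
  ⟨fun i x => (f.app i x, g.app i x), fun i x => Prod.ext (f.naturality i x) (g.naturality i x)⟩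

theorem app_restr {X Y : Tree} (f : X.Hom Y) {i j : ℕ} (h : j ≤ i) (x : X.obj i) :
    Y.restr h (f.app i x) = f.app j (X.restr h x) := by
  induction i, h using Nat.le_induction with
  | base => rw [restr_self, restr_self]
  | succ i h ih => rw [restr_succ Y h, restr_succ X h, f.naturality, ih]

/-- Abstraction: at stage `i`, `γ` is sent to the family of functions `a ↦ f j (γ↾j, a)`. -/
def curry {X Y Z : Tree} (f : (X.prod Y).Hom Z) : X.Hom (Y.exp Z) where
  app i x := ⟨fun j h y => f.app j (X.restr h x, y), fun j h y =>
    (f.naturality j (X.restr h x, y)).trans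
      (congrArg (fun a => f.app j (a, Y.res j y)) (X.res_restr h x))⟩
  naturality i x := by
    apply Subtype.ext
    funext j h y
    exact congrArg (fun a => f.app j (a, y)) (X.restr_succ h x)

/-- Application. -/
def eval {X Y Z : Tree} (f : X.Hom (Y.exp Z)) (g : X.Hom Y) : X.Hom Z where
  app i x := (f.app i x).1 i le_rfl (g.app i x)
  naturality i x := by
    rw [(f.app (i + 1) x).2 i le_rfl, g.naturality, ← f.naturality]
    rfl

/-- Case distinction. -/
def case {X Y Z W : Tree} (f : X.Hom (Y.sum Z)) (g : (X.prod Y).Hom W) (h : (X.prod Z).Hom W) :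
    X.Hom W where
  app i x := Sum.elim (fun y => g.app i (x, y)) (fun z => h.app i (x, z)) (f.app i x)
  naturality i x := by
    have e := f.naturality i x
    rw [← e]
    rcases f.app (i + 1) x with y | z
    · exact g.naturality i (x, y)
    · exact h.naturality i (x, z)

/-- The natural transformation `X → later X`. -/
def next (X : Tree) : X.Hom X.later where
  app
    | 0 => fun _ => ()
    | i + 1 => X.res i
  naturality
    | 0 => fun _ => rfl
    | _ + 1 => fun _ => rfl

/-- The applicative structure of `later`. -/
def ap {X Y Z : Tree} (f : X.Hom (Y.exp Z).later) (g : X.Hom Y.later) : X.Hom Z.later where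
  app
    | 0 => fun _ => ()
    | i + 1 => fun x => (f.app (i + 1) x).1 i le_rfl (g.app (i + 1) x)
  naturality
    | 0 => fun _ => rfl
    | i + 1 => fun x => by
      have e := f.naturality (i + 1) x
      have e' := g.naturality (i + 1) x
      refine (Subtype.prop (f.app (i + 1 + 1) x) i le_rfl _).trans ?_
      change ((Y.exp Z).res i (f.app (i + 1 + 1) x)).1 i le_rfl (Y.res i _) = _
      exact congrArg₂ (fun (a : (Y.exp Z).obj i) b => a.1 i le_rfl b) e e'

/-- `f` applied to a global element. -/
def mapGlob {X Y : Tree} (f : X.Hom Y) (x : X.Glob) : Y.Glob :=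
  ⟨fun i => f.app i (x.1 i), fun i => by rw [f.naturality, x.2]⟩

/-- The arrow `γ ↦ t (σ γ)` one stage later, where the middle object is constant. -/
noncomputable def prev {X Y Z : Tree} (hY : Y.IsConst) (t : Y.Hom Z.later) (σ : X.Hom Y) :
    X.Hom Z where
  app i x := (t.mapGlob (hY.glob i (σ.app i x))).1 (i + 1)
  naturality i x := by
    have e := (t.mapGlob (hY.glob (i + 1) (σ.app (i + 1) x))).2 (i + 1)
    rw [← σ.naturality, hY.glob_res]
    exact e

/-- The arrow sending `γ` to all stages of `t (σ γ)`, where the middle object is constant. -/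
noncomputable def box {X Y Z : Tree} (hY : Y.IsConst) (t : Y.Hom Z) (σ : X.Hom Y) :
    X.Hom Z.box where
  app i x := t.mapGlob (hY.glob i (σ.app i x))
  naturality i x := by
    rw [← σ.naturality, hY.glob_res]
    rfl

/-- The counit of the constant modality. -/
def unbox (X : Tree) : X.box.Hom X := ⟨fun i x => x.1 i, fun i x => x.2 i⟩

end Hom

/-- All stages of a global element of a coproduct are in the same summand. -/
theorem exists_globSum {X Y : Tree} (x : (X.sum Y).Glob) :
    ∃ s : X.Glob ⊕ Y.Glob, ∀ i, x.1 i = Sum.map (fun a => a.1 i) (fun b => b.1 i) s := by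
  rcases hx : x.1 0 with a0 | b0
  · have h : ∀ i, ∃ a, x.1 i = Sum.inl a := by
      intro i
      induction i with
      | zero => exact ⟨a0, hx⟩
      | succ i ih =>
        obtain ⟨a, ha⟩ := ih
        have e := x.2 i
        rw [ha] at e
        rcases hx' : x.1 (i + 1) with a' | b'
        · exact ⟨a', rfl⟩
        · rw [hx'] at e; exact absurd e (by simp [sum])
    choose a ha using h
    refine ⟨Sum.inl ⟨a, fun i => ?_⟩, ha⟩
    have e := x.2 i
    rw [ha, ha] at e
    exact Sum.inl_injective e
  · have h : ∀ i, ∃ b, x.1 i = Sum.inr b := by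
      intro i
      induction i with
      | zero => exact ⟨b0, hx⟩
      | succ i ih =>
        obtain ⟨b, hb⟩ := ih
        have e := x.2 i
        rw [hb] at e
        rcases hx' : x.1 (i + 1) with a' | b'
        · rw [hx'] at e; exact absurd e (by simp [sum])
        · exact ⟨b', rfl⟩
    choose b hb using h
    refine ⟨Sum.inr ⟨b, fun i => ?_⟩, hb⟩
    have e := x.2 i
    rw [hb, hb] at e
    exact Sum.inr_injective e

/-- A global element of a coproduct, as a global element of one of the summands. -/
noncomputable def globSum {X Y : Tree} (x : (X.sum Y).Glob) : X.Glob ⊕ Y.Glob :=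
  (exists_globSum x).choose

/-- The isomorphism from `box (X + Y)` to `box X + box Y`. -/
noncomputable def Hom.boxSum (X Y : Tree) : (X.sum Y).box.Hom (X.box.sum Y.box) where
  app _ x := globSum x
  naturality i x := by
    change Sum.map id id (globSum x) = globSum x
    simp

end Tree

/-- Denotation of a typing context: the product of the denotations of its variables. -/
noncomputable def ctxD (Γ : List (Ty 0)) : Tree where
  obj i := ∀ B, Var Γ B → B.D.obj i
  res i γ := fun B x => B.D.res i (γ B x)

theorem ctxD_isConst {Γ : List (Ty 0)} (h : ∀ B, Var Γ B → B.WF ∧ B.Constant) :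
    (ctxD Γ).IsConst := by
  intro i
  have hb : ∀ B (x : Var Γ B), Function.Bijective (B.D.res i) :=
    fun B x => Ty.D_isConst (h B x).1 (h B x).2 i
  refine ⟨fun a b e => ?_, fun c => ?_⟩
  · funext B x
    exact (hb B x).1 (congrFun (congrFun e B) x)
  · choose a ha using fun B (x : Var Γ B) => (hb B x).2 (c B x)
    exact ⟨a, funext fun B => funext fun x => ha B x⟩

/-- The value of a variable in an extended environment. -/
def consEnv {Γ : List (Ty 0)} {A : Ty 0} {i : ℕ} (γ : (ctxD Γ).obj i) (a : A.D.obj i) :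
    ∀ B, Var (A :: Γ) B → B.D.obj i
  | _, .z => a
  | _, .s x => γ _ x

/-- Extension of an environment. -/
def ctxCons (Γ : List (Ty 0)) (A : Ty 0) : ((ctxD Γ).prod A.D).Hom (ctxD (A :: Γ)) where
  app _ p := consEnv p.1 p.2
  naturality i p := by
    funext B x
    cases x <;> rfl

/-- The arrow into the denotation of a context given by a family of arrows. -/
def tupleHom {X : Tree} {Δ : List (Ty 0)} (σ : ∀ B, Var Δ B → X.Hom B.D) : X.Hom (ctxD Δ) where
  app i x := fun B y => (σ B y).app i x
  naturality i x := by
    funext B y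
    exact (σ B y).naturality i x

/-- Denotation of terms, given a global element for each constant. -/
noncomputable def Tm.den {S : Ty 0 → Type} (I : ∀ A, S A → A.D.Glob) :
    {Γ : List (Ty 0)} → {A : Ty 0} → Term S Γ A → (ctxD Γ).Hom A.D
  | _, _, .atom c => ⟨fun i _ => (I _ c).1 i, fun i _ => (I _ c).2 i⟩
  | _, _, .var x => ⟨fun _ γ => γ _ x, fun _ _ => rfl⟩
  | _, _, .zero => ⟨fun _ _ => (0 : ℕ), fun _ _ => rfl⟩
  | _, _, .succ t =>
    Tree.Hom.comp (Y := Tree.const ℕ) (Z := Tree.const ℕ) ⟨fun _ => Nat.succ, fun _ _ => rfl⟩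
      (t.den I)
  | _, _, .unit => ⟨fun _ _ => (), fun _ _ => rfl⟩
  | _, _, .pair t u => (t.den I).pair (u.den I)
  | _, _, .fst (A := A) (B := B) t =>
    Tree.Hom.comp (Y := A.D.prod B.D) ⟨fun _ => Prod.fst, fun _ _ => rfl⟩ (t.den I)
  | _, _, .snd (A := A) (B := B) t =>
    Tree.Hom.comp (Y := A.D.prod B.D) ⟨fun _ => Prod.snd, fun _ _ => rfl⟩ (t.den I)
  | _, _, .abort _ t =>
    Tree.Hom.comp (Y := Tree.const Empty) ⟨fun _ => Empty.elim, fun _ => Empty.rec⟩ (t.den I)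
  | _, _, .inl (A := A) (B := B) _ t =>
    Tree.Hom.comp (Z := A.D.sum B.D) ⟨fun _ => Sum.inl, fun _ _ => rfl⟩ (t.den I)
  | _, _, .inr (A := A) (B := B) _ t =>
    Tree.Hom.comp (Z := A.D.sum B.D) ⟨fun _ => Sum.inr, fun _ _ => rfl⟩ (t.den I)
  | _, _, .case (A := A) (B := B) t u v =>
    Tree.Hom.case (Y := A.D) (Z := B.D) (t.den I) ((u.den I).comp (ctxCons _ _))
      ((v.den I).comp (ctxCons _ _))
  | _, _, .lam _ t => ((t.den I).comp (ctxCons _ _)).curry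
  | _, _, .app (A := A) t u => Tree.Hom.eval (Y := A.D) (t.den I) (u.den I)
  | _, _, .fold hA hB t => (Tree.Hom.ofEq (by rw [hB]; exact Ty.D_inst hA)).comp (t.den I)
  | _, _, .unfold hA hB t => (Tree.Hom.ofEq (by rw [hB]; exact (Ty.D_inst hA).symm)).comp (t.den I)
  | _, _, .next (A := A) t => (Tree.Hom.next A.D).comp (t.den I)
  | _, _, .prev (A := A) hΔ t σ =>
    Tree.Hom.prev (Z := A.D) (ctxD_isConst hΔ) (t.den I) (tupleHom fun B x => (σ B x).den I)
  | _, _, .ap (A := A) (B := B) t u => Tree.Hom.ap (Y := A.D) (Z := B.D) (t.den I) (u.den I)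
  | _, _, .box hΔ t σ =>
    Tree.Hom.box (ctxD_isConst hΔ) (t.den I) (tupleHom fun B x => (σ B x).den I)
  | _, _, .unbox (A := A) t => (Tree.Hom.unbox A.D).comp (t.den I)
  | _, _, .boxSum (A := A) (B := B) hΔ t σ =>
    (Tree.Hom.boxSum A.D B.D).comp
      (Tree.Hom.box (ctxD_isConst hΔ) (t.den I) (tupleHom fun B x => (σ B x).den I))

/-! ### Derived terms -/

section Derived

variable {S : Ty 0 → Type} {Γ : List (Ty 0)}

/-- The type `Rec A = μα. later α → (later A → A) → A`. -/
def recBody (A : Ty 0) : Ty 1 :=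
  .arr (.later (.var 0)) (.arr (.arr (.later A.weaken) A.weaken) A.weaken)

theorem recBody_wf {A : Ty 0} (hA : A.WF) : (Ty.mu (recBody A)).WF := by
  have h1 : (A.weaken : Ty 1).WF := Ty.wf_rename A _ hA
  have h2 : (A.weaken : Ty 1).Guarded 0 := Ty.guarded_rename A _ _ fun j => j.elim0
  exact ⟨⟨trivial, ⟨trivial, h2⟩, h2⟩, trivial, ⟨h1, h1⟩, h1⟩

theorem recBody_inst (A : Ty 0) :
    Ty.arr (.later (.mu (recBody A))) (.arr (.arr (.later A) A) A) =
      (recBody A).inst (.mu (recBody A)) := by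
  have h := Ty.inst_weaken A (.mu (recBody A))
  change _ = Ty.arr _ (.arr (.arr (.later (A.weaken.inst _)) (A.weaken.inst _)) (A.weaken.inst _))
  rw [h]
  rfl

/-- `θ = λy. λf. f ((next λz. unfold z) ⊛ y ⊛ next y ⊛ next f)`. -/
def thetaTm {A : Ty 0} (hA : A.WF) :
    Term S Γ (.arr (.later (.mu (recBody A))) (.arr (.arr (.later A) A) A)) :=
  .lam (recBody_wf hA) <| .lam (A := .arr (.later A) A) ⟨hA, hA⟩ <|
    .app (.var .z) <|
      .ap (.ap (.ap
        (.next (.lam (recBody_wf hA) (.unfold (recBody_wf hA) (recBody_inst A) (.var .z))))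
        (.var (.s .z))) (.next (.var (.s .z)))) (.next (.var .z))

/-- The guarded fixed point combinator `fix = θ (next (fold θ)) : (later A → A) → A`. -/
def fixTm {A : Ty 0} (hA : A.WF) : Term S Γ (.arr (.arr (.later A) A) A) :=
  .app (thetaTm hA) (.next (.fold (recBody_wf hA) (recBody_inst A) (thetaTm hA)))

/-- `box t` for a closed term `t`. -/
def boxNil {A : Ty 0} (t : Term S [] A) : Term S Γ (.box A) := .box nilConst t nilSubst

/-- The variables of `Δ` as variables of `Δ, Γ`. -/
def Var.appendRight : {Δ : List (Ty 0)} → (Γ : List (Ty 0)) → ∀ B, Var Δ B → Var (Δ ++ Γ) B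
  | _, _, _, .z => .z
  | _, Γ, _, .s x => .s (Var.appendRight Γ _ x)

/-- `box ι. t`, where the variables of `t` are the variables of `Δ`. -/
def boxIota (Δ : List (Ty 0)) (hΔ : ∀ B, Var Δ B → B.WF ∧ B.Constant) {A : Ty 0}
    (t : Term S Δ A) : Term S (Δ ++ Γ) (.box A) :=
  .box hΔ t fun B x => .var (Var.appendRight Γ B x)

/-- `prev ι. t`, where the variables of `t` are the variables of `Δ`. -/
def prevIota (Δ : List (Ty 0)) (hΔ : ∀ B, Var Δ B → B.WF ∧ B.Constant) {A : Ty 0}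
    (t : Term S Δ (.later A)) : Term S (Δ ++ Γ) A :=
  .prev hΔ t fun B x => .var (Var.appendRight Γ B x)

theorem cons_const {Δ : List (Ty 0)} {A : Ty 0} (h : A.WF) (h' : A.Constant)
    (hΔ : ∀ B, Var Δ B → B.WF ∧ B.Constant) : ∀ B, Var (A :: Δ) B → B.WF ∧ B.Constant
  | _, .z => ⟨h, h'⟩
  | _, .s x => hΔ _ x

/-! #### Guarded streams and coinductive streams of natural numbers -/

/-- Guarded streams `μα. nat × later α`. -/
def gStr : Ty 0 := .mu (.prod .nat (.later (.var 0)))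

/-- Coinductive streams `box gStr`. -/
def cStr : Ty 0 := .box gStr

theorem gStr_wf : gStr.WF := ⟨⟨trivial, trivial⟩, trivial, trivial⟩

theorem cStr_wf : cStr.WF := gStr_wf

theorem cStr_const : cStr.Constant := trivial

/-- `λx. λs. fold ⟨x, s⟩` -/
def gconsTm : Term S Γ (.arr .nat (.arr (.later gStr) gStr)) :=
  .lam trivial <| .lam (A := .later gStr) gStr_wf <|
    .fold (B := .prod .nat (.later gStr)) gStr_wf rfl (.pair (.var (.s .z)) (.var .z))

/-- `λs. π₁ (unfold s)` -/
def ghdTm : Term S Γ (.arr gStr .nat) :=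
  .lam gStr_wf (.fst (.unfold (B := .prod .nat (.later gStr)) gStr_wf rfl (.var .z)))

/-- `λs. π₂ (unfold s)` -/
def gtlTm : Term S Γ (.arr gStr (.later gStr)) :=
  .lam gStr_wf (.snd (.unfold (B := .prod .nat (.later gStr)) gStr_wf rfl (.var .z)))

/-- `x :: s` for guarded streams. -/
def gcons (x : Term S Γ .nat) (s : Term S Γ (.later gStr)) : Term S Γ gStr :=
  .app (.app gconsTm x) s

/-- Head of a guarded stream. -/
def ghd (s : Term S Γ gStr) : Term S Γ .nat := .app ghdTm s

/-- Tail of a guarded stream. -/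
def gtl (s : Term S Γ gStr) : Term S Γ (.later gStr) := .app gtlTm s

/-- `fix λs. zero :: s` -/
def gzeros : Term S Γ gStr :=
  .app (fixTm gStr_wf) (.lam (A := .later gStr) gStr_wf (gcons .zero (.var .z)))

/-- `λx. λs. box ι. x :: next (unbox s)` -/
def consTm : Term S Γ (.arr .nat (.arr cStr cStr)) :=
  .lam trivial <| .lam cStr_wf <|
    boxIota [cStr, .nat] (cons_const cStr_wf cStr_const (cons_const trivial trivial nilConst))
      (gcons (.var (.s .z)) (.next (.unbox (.var .z))))

/-- `λs. hd (unbox s)` -/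
def hdTm : Term S Γ (.arr cStr .nat) := .lam cStr_wf (ghd (.unbox (.var .z)))

/-- `λs. box ι. prev ι. tl (unbox s)` -/
def tlTm : Term S Γ (.arr cStr cStr) :=
  .lam cStr_wf <|
    boxIota [cStr] (cons_const cStr_wf cStr_const nilConst) <|
      prevIota (Γ := []) [cStr] (cons_const cStr_wf cStr_const nilConst) (gtl (.unbox (.var .z)))

/-- `x :: s` for coinductive streams. -/
def ccons (x : Term S Γ .nat) (s : Term S Γ cStr) : Term S Γ cStr := .app (.app consTm x) s

/-- Head of a coinductive stream. -/
def chd (s : Term S Γ cStr) : Term S Γ .nat := .app hdTm s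

/-- Tail of a coinductive stream. -/
def ctl (s : Term S Γ cStr) : Term S Γ cStr := .app tlTm s

/-- The coinductive stream of zeros. -/
def czeros : Term S Γ cStr := boxNil gzeros

end Derived

/-! ### Signatures and behavioural differential equations -/

/-- The sorts of first-order terms: the base sort and the sort of streams over it. -/
inductive Srt : Type
  | base
  | str

/-- First-order signatures over the two sorts. -/
structure Sig where
  Op : Type
  arity : Op → ℕ
  dom : ∀ g, Fin (arity g) → Srt
  cod : Op → Srt

/-- The signature `Sg` with one more symbol of sort `str ^ k → str`. -/
def Sig.withSelf (Sg : Sig) (k : ℕ) : Sig where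
  Op := Option Sg.Op
  arity
    | none => k
    | some g => Sg.arity g
  dom
    | none => fun _ => .str
    | some g => Sg.dom g
  cod
    | none => .str
    | some g => Sg.cod g

/-- First-order terms over a signature, with variables in `V`. -/
inductive FTm (Sg : Sig) (V : Srt → Type) : Srt → Type
  | var {s : Srt} (v : V s) : FTm Sg V s
  | op (g : Sg.Op) (a : ∀ i, FTm Sg V (Sg.dom g i)) : FTm Sg V (Sg.cod g)

/-- The variables `x₁, …, x_k` of head terms. -/
inductive HeadVar (k : ℕ) : Srt → Type
  | x (i : Fin k) : HeadVar k .base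

/-- The variables `x₁, …, x_k, y₁, …, y_k, z₁, …, z_k` of tail terms. -/
inductive TailVar (k : ℕ) : Srt → Type
  | x (i : Fin k) : TailVar k .str
  | y (i : Fin k) : TailVar k .str
  | z (i : Fin k) : TailVar k .str

/-- A behavioural differential equation for a `k`-ary stream function `f`, which is the additional
symbol `none` of the signature of the tail term. -/
structure BDE (Sg : Sig) (k : ℕ) where
  head : FTm Sg (HeadVar k) .base
  tail : FTm (Sg.withSelf k) (TailVar k) .str

/-- The types by which the sorts are represented in guarded terms. -/
def gty : Srt → Ty 0
  | .base => .nat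
  | .str => gStr

/-- The types by which the sorts are represented in coinductive terms. -/
def cty : Srt → Ty 0
  | .base => .nat
  | .str => cStr

theorem gty_wf : ∀ s, (gty s).WF
  | .base => trivial
  | .str => gStr_wf

theorem cty_wf : ∀ s, (cty s).WF
  | .base => trivial
  | .str => cStr_wf

theorem cty_const : ∀ s, (cty s).Constant
  | .base => trivial
  | .str => cStr_const

/-- The product type `T (s 0) × (T (s 1) × … × 1)`. -/
def prodTy (T : Srt → Ty 0) : (n : ℕ) → (Fin n → Srt) → Ty 0
  | 0, _ => .one
  | n + 1, s => .prod (T (s 0)) (prodTy T n fun i => s i.succ)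

theorem prodTy_wf {T : Srt → Ty 0} (h : ∀ s, (T s).WF) :
    ∀ (n : ℕ) (s : Fin n → Srt), (prodTy T n s).WF
  | 0, _ => trivial
  | n + 1, _ => ⟨h _, prodTy_wf h n _⟩

theorem prodTy_const {T : Srt → Ty 0} (h : ∀ s, (T s).Constant) :
    ∀ (n : ℕ) (s : Fin n → Srt), (prodTy T n s).Constant
  | 0, _ => trivial
  | n + 1, _ => ⟨h _, prodTy_const h n _⟩

/-- The curried function type `T (s 0) → T (s 1) → … → B`. -/
def curryTy (T : Srt → Ty 0) (B : Ty 0) : (n : ℕ) → (Fin n → Srt) → Ty 0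
  | 0, _ => B
  | n + 1, s => .arr (T (s 0)) (curryTy T B n fun i => s i.succ)

/-- The type of a function symbol in guarded terms. -/
def symTy (Sg : Sig) (g : Sg.Op) : Ty 0 :=
  .arr (prodTy gty (Sg.arity g) (Sg.dom g)) (gty (Sg.cod g))

/-- The constants by which the calculus is extended: the function symbols. -/
inductive Sym (Sg : Sig) : Ty 0 → Type
  | mk (g : Sg.Op) : Sym Sg (symTy Sg g)

section Translation

variable {S : Ty 0 → Type} {Γ : List (Ty 0)} {T : Srt → Ty 0}

/-- The tuple of a family of terms. -/
def tuple : (n : ℕ) → (s : Fin n → Srt) → (∀ i, Term S Γ (T (s i))) →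
    Term S Γ (prodTy T n s)
  | 0, _, _ => .unit
  | n + 1, _, a => .pair (a 0) (tuple n _ fun i => a i.succ)

/-- The components of a tuple. -/
def proj : (n : ℕ) → (s : Fin n → Srt) → Term S Γ (prodTy T n s) → (i : Fin n) →
    Term S Γ (T (s i))
  | n + 1, s, t, i =>
    Fin.cases (motive := fun i => Term S Γ (T (s i))) (.fst t) (fun j => proj n _ (.snd t) j) i

/-- Currying: `λf. λx₁. … λx_n. f ⟨x₁, …, x_n⟩`, defined one argument at a time. -/
def curryTm (hT : ∀ s, (T s).WF) {B : Ty 0} (hB : B.WF) :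
    {Γ : List (Ty 0)} → (n : ℕ) → (s : Fin n → Srt) →
    Term S Γ (.arr (.arr (prodTy T n s) B) (curryTy T B n s))
  | _, 0, _ => .lam (A := .arr .one B) ⟨trivial, hB⟩ (.app (.var .z) .unit)
  | _, n + 1, s =>
    .lam (A := .arr (prodTy T (n + 1) s) B) ⟨prodTy_wf hT (n + 1) s, hB⟩ <| .lam (hT (s 0)) <|
      .app (curryTm hT hB n fun i => s i.succ) <|
        .lam (prodTy_wf hT n fun i => s i.succ) <|
          .app (.var (.s (.s .z))) (.pair (.var (.s .z)) (.var .z))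

/-- `u ⊛ a₁ ⊛ ⋯ ⊛ a_n` -/
def apList {B : Ty 0} : (n : ℕ) → (s : Fin n → Srt) → Term S Γ (.later (curryTy T B n s)) →
    (∀ i, Term S Γ (.later (T (s i)))) → Term S Γ (.later B)
  | 0, _, u, _ => u
  | n + 1, _, u, a => apList n _ (.ap u (a 0)) fun i => a i.succ

/-- The guarded application `curry(u) ⊛ a₁ ⊛ ⋯ ⊛ a_n` of a function that is available later. -/
def gapp {n : ℕ} {s : Fin n → Srt} {r : Srt}
    (u : Term S Γ (.later (.arr (prodTy gty n s) (gty r))))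
    (a : ∀ i, Term S Γ (.later (gty (s i)))) : Term S Γ (.later (gty r)) :=
  apList n s (.ap (.next (curryTm gty_wf (gty_wf r) n s)) u) a

/-- `unbox` at the sort of streams. -/
def unlift : (s : Srt) → Term S Γ (cty s) → Term S Γ (gty s)
  | .base, t => t
  | .str, t => .unbox t

/-- `unbox` at the base sort. -/
def relift : (s : Srt) → Term S Γ (.box (gty s)) → Term S Γ (cty s)
  | .base, t => .unbox t
  | .str, t => t

/-- The lifting of functions on guarded streams to functions on coinductive streams,
`λf. λy. box ι. (unbox f) ⟨unbox y₁, …, unbox y_n⟩`, where arguments and results of the base sort are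
left as they are. -/
def limTm (n : ℕ) (s : Fin n → Srt) (r : Srt) :
    Term S Γ (.arr (.box (.arr (prodTy gty n s) (gty r))) (.arr (prodTy cty n s) (cty r))) :=
  have hf : (Ty.box (.arr (prodTy gty n s) (gty r)) : Ty 0).WF := ⟨prodTy_wf gty_wf n s, gty_wf r⟩
  have hy : (prodTy cty n s).WF := prodTy_wf cty_wf n s
  .lam hf <| .lam hy <| relift r <|
    boxIota [prodTy cty n s, .box (.arr (prodTy gty n s) (gty r))]
      (cons_const hy (prodTy_const cty_const n s) (cons_const hf trivial nilConst)) <|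
        .app (.unbox (.var (.s .z))) (tuple n s fun i => unlift (s i) (proj n s (.var .z) i))

/-- The function obtained by lifting a closed function on guarded streams. -/
def limit {n : ℕ} {s : Fin n → Srt} {r : Srt}
    (t : Term S [] (.arr (prodTy gty n s) (gty r))) :
    Term S Γ (.arr (prodTy cty n s) (cty r)) :=
  .app (limTm n s r) (boxNil t)

end Translation

section Translation

variable {Sg : Sig} {Γ : List (Ty 0)} {k : ℕ}

/-- The guarded term of a head term, with terms `X` in place of the variables. -/
def gHead (X : Fin k → Term (Sym Sg) Γ .nat) :
    {s : Srt} → FTm Sg (HeadVar k) s → Term (Sym Sg) Γ (gty s)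
  | _, .var (.x i) => X i
  | _, .op g a => .app (.atom (.mk g)) (tuple _ _ fun i => gHead X (a i))

/-- The guarded term of a tail term, with terms `X`, `Y`, `Z` in place of the variables and `F` in
place of the recursive function. -/
def gTail (X Y : Fin k → Term (Sym Sg) Γ gStr) (Z : Fin k → Term (Sym Sg) Γ (.later gStr))
    (F : Term (Sym Sg) Γ (.later (.arr (prodTy gty k fun _ => .str) gStr))) :
    {s : Srt} → FTm (Sg.withSelf k) (TailVar k) s → Term (Sym Sg) Γ (.later (gty s))
  | _, .var (.x i) => .next (X i)
  | _, .var (.y i) => .next (Y i)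
  | _, .var (.z i) => Z i
  | _, .op none a => gapp (s := fun _ => .str) (r := .str) F fun i => gTail X Y Z F (a i)
  | _, .op (some g) a => gapp (.next (.atom (.mk g))) fun i => gTail X Y Z F (a i)

/-- The coinductive term of a head term. -/
def cHead (X : Fin k → Term (Sym Sg) Γ .nat) :
    {s : Srt} → FTm Sg (HeadVar k) s → Term (Sym Sg) Γ (cty s)
  | _, .var (.x i) => X i
  | _, .op g a => .app (limit (.atom (.mk g))) (tuple _ _ fun i => cHead X (a i))

/-- The coinductive term of a tail term. -/
def cTail (X Y Z : Fin k → Term (Sym Sg) Γ cStr)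
    (F : Term (Sym Sg) Γ (.arr (prodTy cty k fun _ => .str) cStr)) :
    {s : Srt} → FTm (Sg.withSelf k) (TailVar k) s → Term (Sym Sg) Γ (cty s)
  | _, .var (.x i) => X i
  | _, .var (.y i) => Y i
  | _, .var (.z i) => Z i
  | _, .op none a => .app F (tuple (T := cty) k (fun _ => .str) fun i => cTail X Y Z F (a i))
  | _, .op (some g) a => .app (limit (.atom (.mk g))) (tuple _ _ fun i => cTail X Y Z F (a i))

/-- The type of `k`-ary functions on guarded streams. -/
def gFun (k : ℕ) : Ty 0 := .arr (prodTy gty k fun _ => .str) gStr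

/-- The type of `k`-ary functions on coinductive streams. -/
def cFun (k : ℕ) : Ty 0 := .arr (prodTy cty k fun _ => .str) cStr

theorem gFun_wf (k : ℕ) : (gFun k).WF := ⟨prodTy_wf gty_wf k _, gStr_wf⟩

theorem cFun_wf (k : ℕ) : (cFun k).WF := ⟨prodTy_wf cty_wf k _, cStr_wf⟩

namespace BDE

/-- The right-hand side `h[hd yᵢ / xᵢ]` for coinductive streams `y`. -/
def headRhs (e : BDE Sg k) (y : Fin k → Term (Sym Sg) Γ cStr) : Term (Sym Sg) Γ .nat :=
  cHead (fun i => chd (y i)) e.head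

/-- The right-hand side `t[(hd yᵢ :: zeros) / xᵢ, tl yᵢ / zᵢ]` for coinductive streams `y` and a
function `F` on coinductive streams. -/
def tailRhs (e : BDE Sg k) (F : Term (Sym Sg) Γ (cFun k)) (y : Fin k → Term (Sym Sg) Γ cStr) :
    Term (Sym Sg) Γ cStr :=
  cTail (fun i => ccons (chd (y i)) czeros) y (fun i => ctl (y i)) F e.tail

/-- The term `λf. λy. h[hd yᵢ / xᵢ] :: t[(hd yᵢ :: next zeros) / xᵢ, tl yᵢ / zᵢ]` on guarded
streams. -/
def gPhi (e : BDE Sg k) : Term (Sym Sg) Γ (.arr (.later (gFun k)) (gFun k)) :=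
  .lam (A := .later (gFun k)) (gFun_wf k) <| .lam (prodTy_wf gty_wf k fun _ => .str) <|
    let y : Fin k → Term (Sym Sg) _ gStr := proj (T := gty) k (fun _ => .str) (.var .z)
    gcons (gHead (fun i => ghd (y i)) e.head)
      (gTail (fun i => gcons (ghd (y i)) (.next gzeros)) y (fun i => gtl (y i)) (.var (.s .z))
        e.tail)

/-- The corresponding term `λf. λy. h :: t` on coinductive streams. -/
def cPhi (e : BDE Sg k) : Term (Sym Sg) Γ (.arr (cFun k) (cFun k)) :=
  .lam (cFun_wf k) <| .lam (prodTy_wf cty_wf k fun _ => .str) <|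
    let y : Fin k → Term (Sym Sg) _ cStr := proj (T := cty) k (fun _ => .str) (.var .z)
    ccons (e.headRhs y) (e.tailRhs (.var (.s .z)) y)

/-- The guarded function `fix gPhi`. -/
def gSol (e : BDE Sg k) : Term (Sym Sg) Γ (gFun k) := .app (fixTm (gFun_wf k)) e.gPhi

/-- The lifting of the guarded function to coinductive streams. -/
def cSol (e : BDE Sg k) : Term (Sym Sg) Γ (cFun k) :=
  limit (s := fun _ => .str) (r := .str) e.gSol

end BDE

/-! ### Interpretations of signatures -/

/-- An interpretation of a signature in the topos of trees: an arrow for each function symbol. -/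
def Interp (Sg : Sig) : Type :=
  ∀ g : Sg.Op, (prodTy gty (Sg.arity g) (Sg.dom g)).D.Hom (gty (Sg.cod g)).D

/-- The global element of an exponential given by an arrow. -/
def Tree.Hom.name {X Y : Tree} (f : X.Hom Y) : (X.exp Y).Glob :=
  ⟨fun _ => ⟨fun j _ => f.app j, fun j _ => f.naturality j⟩, fun _ => rfl⟩

/-- The interpretation of the function symbols as global elements. -/
noncomputable def Interp.glob (I : Interp Sg) : ∀ A, Sym Sg A → A.D.Glob
  | _, .mk g => (I g).name

/-- Equality of terms in the model: they denote the same arrow. -/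
def Interp.Eq (I : Interp Sg) {A : Ty 0} (t u : Term (Sym Sg) Γ A) : Prop :=
  t.den I.glob = u.den I.glob

/-- An implementation of a signature: a closed term for each function symbol. -/
def Impl (Sg : Sig) : Type := ∀ g : Sg.Op, Pure [] (symTy Sg g)

/-- The term of the calculus obtained by replacing the function symbols by their implementations. -/
def Impl.inst (E : Impl Sg) {A : Ty 0} (t : Term (Sym Sg) Γ A) : Pure Γ A :=
  t.bindAtoms fun _ _ c => match c with
    | .mk g => (E g).rename fun _ x => nomatch x

/-- Contextual equivalence of terms under an implementation of the function symbols. -/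
def Impl.Eq (E : Impl Sg) {A : Ty 0} (t u : Term (Sym Sg) Γ A) : Prop :=
  CtxEq (E.inst t) (E.inst u)

end Translation

end GLambda

/-! Part (1) is a computation in the topos of trees. At stage `i + 1` the object `later X` is `X` at
stage `i`, and at stage `0` it is a point. Hence a fixed point of an operation from `later A` to `A`
is determined stage by stage: nothing is fed in at stage `0`, and stage `i + 1` depends only on what
is already known at stage `i` (`fix_unique`). Unrolling the Turing combinator once shows that it
provides such a fixed point (`den_fix`).

An element of `box A` is a global element of `A`, a compatible family over all stages, so
coinductive terms can be computed componentwise. Component `j` of a lifted function applied to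
streams is the guarded function at stage `j` applied to the components `j` of the streams
(`down_limit`). Since `prev` reads one stage later, component `j` of a tail is the guarded tail of
component `j + 1` (`den_ctl`). The guarded reading of a tail term lives under `later`: its value at
stage `j + 1` is built from ordinary applications at stage `j` (`den_gapp`), and therefore agrees
with component `j` of the coinductive reading (`den_gTail`; `den_gHead` for head terms). Unrolling
the guarded fixed point at the appropriate stages thus gives the head and tail equations
(`den_chd_app`, `den_ctl_app`). As a stream is the cons of its head and tail, these two equations
make the lifted solution a fixed point (`den_ccons_app`, `den_cPhi`).

For part (2), the symbols are interpreted by the denotations of their implementations, so the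
equations of denotations are available. Denotations are compositional, so it remains to see that a
closed term of type `nat` reduces to the numeral it denotes (`steps_numeral`). This is proved with a
logical relation `Realizes` between elements at a stage and closed terms, which every term respects
(`realizes_den`). The delicate term-formers are `prev`, `box` and `boxSum`, whose bodies are
evaluated at stages other than that of the environment. Their contexts consist of constant types,
for which the relation is independent of the stage (`Realizes.const_iff`). For `boxSum` the reducts
found at the various stages must moreover coincide, which is where determinism of reduction enters.
-/

namespace GLambda

/-! ### Substitution -/

namespace Tm

variable {S : Ty 0 → Type}

/-- Extension of a substitution by a term for the last variable. -/
def consSubst {Γ Δ : List (Ty 0)} {A : Ty 0} (u : Term S Δ A) (τ : ∀ B, Var Γ B → Term S Δ B) :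
    ∀ B, Var (A :: Γ) B → Term S Δ B
  | _, .z => u
  | _, .s x => τ _ x

theorem rename_rename {Γ : List (Ty 0)} {A : Ty 0} (t : Term S Γ A) :
    ∀ {Δ Θ : List (Ty 0)} (r : ∀ B, Var Γ B → Var Δ B) (s : ∀ B, Var Δ B → Var Θ B),
      (t.rename r).rename s = t.rename fun B x => s B (r B x) := by
  have lift : ∀ {Γ Δ Θ : List (Ty 0)} (r : ∀ B, Var Γ B → Var Δ B) (s : ∀ B, Var Δ B → Var Θ B)
      (A : Ty 0), (fun B x => Var.lift s A B (Var.lift r A B x)) =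
        Var.lift (fun B x => s B (r B x)) A := by
    intro Γ Δ Θ r s A
    funext B x
    cases x <;> rfl
  induction t <;> intro Δ Θ r s <;> simp only [rename, *]

theorem rename_subst {Γ : List (Ty 0)} {A : Ty 0} (t : Term S Γ A) :
    ∀ {Δ Θ : List (Ty 0)} (r : ∀ B, Var Γ B → Var Δ B) (τ : ∀ B, Var Δ B → Term S Θ B),
      (t.rename r).subst τ = t.subst fun B x => τ B (r B x) := by
  have lift : ∀ {Γ Δ Θ : List (Ty 0)} (r : ∀ B, Var Γ B → Var Δ B)
      (τ : ∀ B, Var Δ B → Term S Θ B) (A : Ty 0),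
      (fun B x => liftSubst τ A B (Var.lift r A B x)) =
        liftSubst (fun B x => τ B (r B x)) A := by
    intro Γ Δ Θ r τ A
    funext B x
    cases x <;> rfl
  induction t <;> intro Δ Θ r τ <;> simp only [rename, subst, *]

theorem subst_rename {Γ : List (Ty 0)} {A : Ty 0} (t : Term S Γ A) :
    ∀ {Δ Θ : List (Ty 0)} (τ : ∀ B, Var Γ B → Term S Δ B) (r : ∀ B, Var Δ B → Var Θ B),
      (t.subst τ).rename r = t.subst fun B x => (τ B x).rename r := by
  have lift : ∀ {Γ Δ Θ : List (Ty 0)} (τ : ∀ B, Var Γ B → Term S Δ B)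
      (r : ∀ B, Var Δ B → Var Θ B) (A : Ty 0),
      (fun B x => (liftSubst τ A B x).rename (Var.lift r A)) =
        liftSubst (fun B x => (τ B x).rename r) A := by
    intro Γ Δ Θ τ r A
    funext B x
    cases x with
    | z => rfl
    | s x => simp only [liftSubst, rename_rename]; rfl
  induction t <;> intro Δ Θ τ r <;> simp only [rename, subst, *]

theorem subst_subst {Γ : List (Ty 0)} {A : Ty 0} (t : Term S Γ A) :
    ∀ {Δ Θ : List (Ty 0)} (τ : ∀ B, Var Γ B → Term S Δ B) (υ : ∀ B, Var Δ B → Term S Θ B),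
      (t.subst τ).subst υ = t.subst fun B x => (τ B x).subst υ := by
  have lift : ∀ {Γ Δ Θ : List (Ty 0)} (τ : ∀ B, Var Γ B → Term S Δ B)
      (υ : ∀ B, Var Δ B → Term S Θ B) (A : Ty 0),
      (fun B x => (liftSubst τ A B x).subst (liftSubst υ A)) =
        liftSubst (fun B x => (τ B x).subst υ) A := by
    intro Γ Δ Θ τ υ A
    funext B x
    cases x with
    | z => rfl
    | s x => simp only [liftSubst, rename_subst, subst_rename]
  induction t <;> intro Δ Θ τ υ <;> simp only [subst, *]

theorem subst_var {Γ : List (Ty 0)} {A : Ty 0} (t : Term S Γ A) :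
    t.subst (fun _ x => .var x) = t := by
  have lift : ∀ (Γ : List (Ty 0)) (A : Ty 0),
      liftSubst (fun B (x : Var Γ B) => (.var x : Term S Γ B)) A = fun _ x => .var x := by
    intro Γ A
    funext B x
    cases x <;> rfl
  induction t <;> simp only [subst, *]

theorem subst_closed {A : Ty 0} (t : Term S [] A) (τ : ∀ B, Var [] B → Term S [] B) :
    t.subst τ = t := by
  conv_rhs => rw [← subst_var t]
  congr 1
  funext B x
  nomatch x

/-- Relates the two substitutions that meet when a redex is contracted under a closing substitution:
the closing one, lifted under the binder, and that of the argument. Together they form the extended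
environment to which the induction hypothesis of `realizes_den` applies. -/
theorem subst_lift_single {Γ Δ : List (Ty 0)} {A B : Ty 0} (t : Term S (A :: Γ) B)
    (τ : ∀ B, Var Γ B → Term S Δ B) (u : Term S Δ A) :
    (t.subst (liftSubst τ A)).subst (single u) = t.subst (consSubst u τ) := by
  rw [subst_subst]
  congr 1
  funext B x
  cases x with
  | z => rfl
  | s x => simp only [liftSubst, rename_subst]; exact subst_var _

end Tm

/-! ### Determinism of reduction -/

/-- Among the values only `succ` has an evaluation rule for its argument, and there the argument is
again a value; all other values are headed by constructors that never reduce. -/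
theorem IsValue.not_step {A : Ty 0} {v w : Pure [] A} (hv : IsValue v) : ¬ Step v w := by
  intro h
  induction hv with
  | succ _ ih => cases h with | succ h => exact ih h
  | _ => cases h

theorem Step.deterministic {A : Ty 0} {t u v : Pure [] A} (h : Step t u) (h' : Step t v) :
    u = v := by
  induction h with
  | _ =>
    cases h' <;> first
    | rfl
    -- The rules that carry out an explicit substitution require a nonempty context, while the other
    -- rules for `prev` and `boxSum` apply to the empty context only.
    | exact absurd rfl ‹_ ≠ _›
    | cases ‹Step (Tm.pair _ _) _›
    | cases ‹Step (Tm.inl _ _) _›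
    | cases ‹Step (Tm.inr _ _) _›
    | cases ‹Step (Tm.lam _ _) _›
    | cases ‹Step (Tm.fold _ _ _) _›
    | cases ‹Step (Tm.next _) _›
    | cases ‹Step (Tm.box _ _ _) _›
    | exact absurd (by assumption) (IsValue.not_step ‹IsValue _›)
    | (rename_i s _ _ hv _; exact absurd s hv.not_step)
    | (rename_i ih _ h; rw [ih h])
    | (rename_i ih _ _ h; rw [ih h])
    | (rename_i ih _ _ _ h; rw [ih h])

/-- Reduction to values has at most one result. -/
theorem IsValue.eq_of_reduces {A : Ty 0} {t v w : Pure [] A} (hv : IsValue v) (hw : IsValue w)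
    (h : Relation.ReflTransGen Step t v) (h' : Relation.ReflTransGen Step t w) : v = w := by
  induction h using Relation.ReflTransGen.head_induction_on with
  | refl =>
    rcases h'.cases_head with e | ⟨_, h, _⟩
    · exact e
    · exact absurd h hv.not_step
  | head s _ ih =>
    rcases h'.cases_head with rfl | ⟨_, s', h'⟩
    · exact absurd s hw.not_step
    · exact ih (s.deterministic s' ▸ h')


/-! ### Adequacy -/

/-! ### Measures on types, and induction on types and stages -/

namespace Ty

/-- The nesting depth of `box`. -/
def boxDepth : {n : ℕ} → Ty n → ℕ
  | _, .var _ => 0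
  | _, .nat => 0
  | _, .one => 0
  | _, .prod A B => max A.boxDepth B.boxDepth
  | _, .zero => 0
  | _, .sum A B => max A.boxDepth B.boxDepth
  | _, .arr A B => max A.boxDepth B.boxDepth
  | _, .mu A => A.boxDepth
  | _, .later A => A.boxDepth
  | _, .box A => A.boxDepth + 1

/-- The number of binary type-formers and binders that are not beneath a modality. -/
def unguardedSize : {n : ℕ} → Ty n → ℕ
  | _, .var _ => 0
  | _, .nat => 0
  | _, .one => 0
  | _, .prod A B => A.unguardedSize + B.unguardedSize + 1
  | _, .zero => 0
  | _, .sum A B => A.unguardedSize + B.unguardedSize + 1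
  | _, .arr A B => A.unguardedSize + B.unguardedSize + 1
  | _, .mu A => A.unguardedSize + 1
  | _, .later _ => 0
  | _, .box _ => 0

theorem boxDepth_rename {n : ℕ} (A : Ty n) : ∀ {m : ℕ} (r : Fin n → Fin m),
    (A.rename r).boxDepth = A.boxDepth := by
  induction A <;> intro m r <;> simp only [rename, boxDepth, *]

theorem unguardedSize_rename {n : ℕ} (A : Ty n) : ∀ {m : ℕ} (r : Fin n → Fin m),
    (A.rename r).unguardedSize = A.unguardedSize := by
  induction A <;> intro m r <;> simp only [rename, unguardedSize, *]

/-- Types beneath `box` are closed and untouched by substitution, so `box` is never nested more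
deeply than in the pieces. -/
theorem boxDepth_subst_le {n : ℕ} (A : Ty n) : ∀ {m d : ℕ} (σ : Fin n → Ty m),
    (∀ i, (σ i).boxDepth ≤ d) → A.boxDepth ≤ d → (A.subst σ).boxDepth ≤ d := by
  induction A with
  | var i => exact fun σ h _ => h i
  | nat | one | zero | box => exact fun σ _ h => h
  | prod A B ihA ihB | sum A B ihA ihB | arr A B ihA ihB =>
    exact fun σ h h' => max_le (ihA σ h (le_of_max_le_left h')) (ihB σ h (le_of_max_le_right h'))
  | later A ih => exact fun σ h h' => ih σ h h'
  | mu A ih =>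
    intro m d σ h h'
    refine ih _ (fun i => ?_) h'
    refine Fin.cases (Nat.zero_le _) (fun j => ?_) i
    rw [Fin.cons_succ, boxDepth_rename]
    exact h j

/-- Only what is substituted outside the modalities is counted, so the sizes of types put for
guarded variables are irrelevant. -/
theorem unguardedSize_subst {n : ℕ} (A : Ty n) : ∀ {m : ℕ} (σ : Fin n → Ty m),
    (∀ i, ¬ A.Guarded i → (σ i).unguardedSize = 0) →
    (A.subst σ).unguardedSize = A.unguardedSize := by
  induction A with
  | var i => exact fun σ h => h i fun h => h rfl
  | nat | one | zero | box | later => exact fun σ _ => rfl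
  | prod A B ihA ihB | sum A B ihA ihB | arr A B ihA ihB =>
    intro m σ h
    simp only [subst, unguardedSize]
    rw [ihA σ fun i g => h i fun k => g k.1, ihB σ fun i g => h i fun k => g k.2]
  | mu A ih =>
    intro m σ h
    simp only [subst, unguardedSize, Nat.add_right_cancel_iff]
    refine ih _ fun i => ?_
    refine Fin.cases (fun _ => rfl) (fun j g => ?_) i
    rw [Fin.cons_succ, unguardedSize_rename]
    exact h j g

theorem guarded_subst {n : ℕ} (A : Ty n) : ∀ {m : ℕ} (σ : Fin n → Ty m) (i : Fin m),
    (∀ j, ¬ A.Guarded j → (σ j).Guarded i) → (A.subst σ).Guarded i := by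
  induction A with
  | var j => exact fun σ i h => h j fun h => h rfl
  | nat | one | zero | box | later => exact fun σ i _ => trivial
  | prod A B ihA ihB | sum A B ihA ihB | arr A B ihA ihB =>
    exact fun σ i h =>
      ⟨ihA σ i fun j g => h j fun k => g k.1, ihB σ i fun j g => h j fun k => g k.2⟩
  | mu A ih =>
    intro m σ i h
    refine ih _ _ fun j => ?_
    refine Fin.cases (fun _ => Fin.succ_ne_zero i) (fun j g => ?_) j
    rw [Fin.cons_succ]
    refine guarded_rename _ _ _ fun k e => ?_
    rw [Fin.succ_injective _ e]
    exact h j g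

theorem wf_subst {n : ℕ} (A : Ty n) : ∀ {m : ℕ} (σ : Fin n → Ty m),
    (∀ j, (σ j).WF) → A.WF → (A.subst σ).WF := by
  induction A with
  | var j => exact fun σ h _ => h j
  | nat | one | zero => exact fun σ _ _ => trivial
  | box => exact fun σ _ w => w
  | later A ih => exact fun σ h w => ih σ h w
  | prod A B ihA ihB | sum A B ihA ihB | arr A B ihA ihB =>
    exact fun σ h w => ⟨ihA σ h w.1, ihB σ h w.2⟩
  | mu A ih =>
    intro m σ h w
    refine ⟨guarded_subst A _ _ fun j => ?_, ih _ (fun j => ?_) w.2⟩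
    · refine Fin.cases (fun g => absurd w.1 g) (fun j _ => ?_) j
      rw [Fin.cons_succ]
      exact guarded_rename _ _ _ fun k e => absurd e (Fin.succ_ne_zero k)
    · refine Fin.cases trivial (fun j => ?_) j
      rw [Fin.cons_succ]
      exact wf_rename _ _ (h j)

theorem constant_rename {n : ℕ} (A : Ty n) : ∀ {m : ℕ} (r : Fin n → Fin m),
    A.Constant → (A.rename r).Constant := by
  induction A with
  | prod A B ihA ihB | sum A B ihA ihB | arr A B ihA ihB =>
    exact fun r c => ⟨ihA r c.1, ihB r c.2⟩
  | mu A ih => exact fun r c => ih _ c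
  | _ => exact fun _ c => c

theorem constant_subst {n : ℕ} (A : Ty n) : ∀ {m : ℕ} (σ : Fin n → Ty m),
    (∀ j, (σ j).Constant) → A.Constant → (A.subst σ).Constant := by
  induction A with
  | var j => exact fun σ h _ => h j
  | nat | one | zero | box => exact fun σ _ _ => trivial
  | later A ih => exact fun σ h c => c.elim
  | prod A B ihA ihB | sum A B ihA ihB | arr A B ihA ihB =>
    exact fun σ h w => ⟨ihA σ h w.1, ihB σ h w.2⟩
  | mu A ih =>
    intro m σ h c
    refine ih _ (fun j => ?_) c
    refine Fin.cases trivial (fun j => ?_) j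
    rw [Fin.cons_succ]
    exact constant_rename _ _ (h j)

theorem boxDepth_inst_le (A : Ty 1) : (A.inst (mu A)).boxDepth ≤ (mu A).boxDepth :=
  boxDepth_subst_le A _ (fun _ => le_rfl) le_rfl

/-- The copies of `mu A` created by unfolding all lie beneath `later` and count as nothing, while
the outer binder disappears. -/
theorem unguardedSize_inst_lt {A : Ty 1} (hA : (mu A).WF) :
    (A.inst (mu A)).unguardedSize < (mu A).unguardedSize := by
  refine Nat.lt_succ_of_le (unguardedSize_subst A _ fun i g => ?_).le
  exact absurd (Subsingleton.elim 0 i ▸ hA.1) g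

/-- The termination order of definitions by recursion on a type and a stage. -/
theorem lex_of_le {d d' : ℕ} {q q' : ℕ × ℕ} (h : d ≤ d')
    (h' : Prod.Lex (· < ·) (· < ·) q q') :
    Prod.Lex (· < ·) (Prod.Lex (· < ·) (· < ·)) (d, q) (d', q') := by
  rcases h.lt_or_eq with h | rfl
  · exact Prod.Lex.left _ _ h
  · exact Prod.Lex.right _ h'

theorem lex_of_le_of_lt {i i' s s' : ℕ} (h : i ≤ i') (h' : s < s') :
    Prod.Lex (· < ·) (· < ·) (i, s) (i', s') := by
  rcases h.lt_or_eq with h | rfl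
  · exact Prod.Lex.left _ _ h
  · exact Prod.Lex.right _ h'

/-- Induction on types and stages: recursive types are unfolded, and the type beneath `box` is
considered at all stages. -/
theorem stage_induction {P : Ty 0 → ℕ → Prop} (nat : ∀ i, P .nat i) (one : ∀ i, P .one i)
    (prod : ∀ A B i, P A i → P B i → P (.prod A B) i) (zero : ∀ i, P .zero i)
    (sum : ∀ A B i, P A i → P B i → P (.sum A B) i)
    (arr : ∀ A B i, (∀ j ≤ i, P A j) → (∀ j ≤ i, P B j) → P (.arr A B) i)
    (mu : ∀ A i, ((Ty.mu A).WF → P (A.inst (.mu A)) i) → P (.mu A) i)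
    (later_zero : ∀ A, P (.later A) 0) (later_succ : ∀ A i, P A i → P (.later A) (i + 1))
    (box : ∀ A i, (∀ j, P A j) → P (.box A) i) : ∀ A i, P A i
  | .nat, i => nat i
  | .one, i => one i
  | .prod A B, i => prod A B i
      (stage_induction nat one prod zero sum arr mu later_zero later_succ box A i)
      (stage_induction nat one prod zero sum arr mu later_zero later_succ box B i)
  | .zero, i => zero i
  | .sum A B, i => sum A B i
      (stage_induction nat one prod zero sum arr mu later_zero later_succ box A i)
      (stage_induction nat one prod zero sum arr mu later_zero later_succ box B i)
  | .arr A B, i => arr A B i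
      (fun j _ => stage_induction nat one prod zero sum arr mu later_zero later_succ box A j)
      (fun j _ => stage_induction nat one prod zero sum arr mu later_zero later_succ box B j)
  -- The well-formedness assumption bound here is what makes the measure decrease: unfolding an
  -- unguarded variable need not lower the size.
  | .mu A, i => mu A i fun _ =>
      stage_induction nat one prod zero sum arr mu later_zero later_succ box (A.inst (.mu A)) i
  | .later A, 0 => later_zero A
  | .later A, i + 1 => later_succ A i
      (stage_induction nat one prod zero sum arr mu later_zero later_succ box A i)
  | .box A, i => box A i fun j =>
      stage_induction nat one prod zero sum arr mu later_zero later_succ box A j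
-- `box` lowers the first component, which leaves the stage free; `later` lowers the stage, which
-- leaves the size free; unfolding and the binary type-formers lower the size without raising the
-- stage.
termination_by A i => (A.boxDepth, i, A.unguardedSize)
decreasing_by
  all_goals first
    | exact lex_of_le (le_max_left _ _)
        (lex_of_le_of_lt (by first | exact le_rfl | assumption)
          (by simp only [unguardedSize]; omega))
    | exact lex_of_le (le_max_right _ _)
        (lex_of_le_of_lt (by first | exact le_rfl | assumption)
          (by simp only [unguardedSize]; omega))
    | exact lex_of_le (boxDepth_inst_le A)
        (lex_of_le_of_lt le_rfl (unguardedSize_inst_lt (by assumption)))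
    | exact lex_of_le le_rfl (Prod.Lex.left _ _ (Nat.lt_succ_self i))
    | exact Prod.Lex.left _ _ (Nat.lt_succ_self _)

theorem unfold_eq {A : Ty 1} (hA : (mu A).WF) : (mu A).D = (A.inst (.mu A)).D :=
  (D_inst hA).symm

end Ty

/-! ### The realizability relation -/

/-- The numeral of a natural number. -/
def numeral : ℕ → Pure [] .nat
  | 0 => .zero
  | n + 1 => .succ (numeral n)

theorem numeral_isValue : ∀ n, IsValue (numeral n)
  | 0 => .zero
  | n + 1 => .succ (numeral_isValue n)

/-- Reduction in any number of steps. -/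
abbrev Steps {A : Ty 0} : Pure [] A → Pure [] A → Prop := Relation.ReflTransGen Step

/-- The arrow that unfolds a recursive type. -/
noncomputable def Ty.unfoldHom {A : Ty 1} (hA : (Ty.mu A).WF) :
    (Ty.mu A).D.Hom (A.inst (.mu A)).D :=
  Tree.Hom.ofEq (Ty.unfold_eq hA)

/-- The closed term `t` realizes the element `a` of the denotation of its type at stage `i`. -/
def Realizes : (A : Ty 0) → (i : ℕ) → A.D.obj i → Pure [] A → Prop
  | .nat, _, a, t => Steps t (numeral a)
  | .one, _, _, _ => True
  | .prod A B, i, a, t =>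
    let a : (A.D.prod B.D).obj i := a
    Realizes A i a.1 (.fst t) ∧ Realizes B i a.2 (.snd t)
  | .zero, _, _, _ => False
  | .sum A B, i, a, t =>
    let a : (A.D.sum B.D).obj i := a
    (∃ x h u, a = Sum.inl x ∧ Steps t (.inl h u) ∧ Realizes A i x u) ∨
      ∃ x h u, a = Sum.inr x ∧ Steps t (.inr h u) ∧ Realizes B i x u
  | .arr A B, i, a, t =>
    let a : (A.D.exp B.D).obj i := a
    -- Quantifying over all earlier stages makes the relation stable under restriction, although
    -- functions are contravariant in their arguments.
    ∀ j (h : j ≤ i) x u, Realizes A j x u → Realizes B j (a.1 j h x) (.app t u)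
  | .mu A, i, a, t =>
    -- The guard `h` is needed for the recursion to be well-founded. Like products, functions and
    -- `box`, a recursive type is tested by its eliminator; sums and `later` are tested by reduction
    -- to a value.
    ∀ h : (Ty.mu A).WF, Realizes (A.inst (.mu A)) i ((Ty.unfoldHom h).app i a) (.unfold h rfl t)
  -- Stage `0` of `later` is a point, so it promises nothing about the term.
  | .later _, 0, _, _ => True
  | .later A, i + 1, a, t => ∃ u, Steps t (.next u) ∧ Realizes A i a u
  | .box A, _, a, t =>
    let a : A.D.Glob := a
    ∀ j, Realizes A j (a.1 j) (.unbox t)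
termination_by A i => (A.boxDepth, i, A.unguardedSize)
decreasing_by
  · exact Ty.lex_of_le (le_max_left _ _)
      (Ty.lex_of_le_of_lt le_rfl (by simp only [Ty.unguardedSize]; omega))
  · exact Ty.lex_of_le (le_max_right _ _)
      (Ty.lex_of_le_of_lt le_rfl (by simp only [Ty.unguardedSize]; omega))
  · exact Ty.lex_of_le (le_max_left _ _)
      (Ty.lex_of_le_of_lt le_rfl (by simp only [Ty.unguardedSize]; omega))
  · exact Ty.lex_of_le (le_max_right _ _)
      (Ty.lex_of_le_of_lt le_rfl (by simp only [Ty.unguardedSize]; omega))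
  · exact Ty.lex_of_le (le_max_left _ _)
      (Ty.lex_of_le_of_lt h (by simp only [Ty.unguardedSize]; omega))
  · exact Ty.lex_of_le (le_max_right _ _)
      (Ty.lex_of_le_of_lt h (by simp only [Ty.unguardedSize]; omega))
  · exact Ty.lex_of_le (Ty.boxDepth_inst_le A)
      (Ty.lex_of_le_of_lt le_rfl (Ty.unguardedSize_inst_lt h))
  · exact Ty.lex_of_le le_rfl (Prod.Lex.left _ _ (Nat.lt_succ_self i))
  · exact Prod.Lex.left _ _ (Nat.lt_succ_self _)



/-! ### Closure under expansion, restriction and change of stage -/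

namespace Realizes

/-- Where the relation tests an eliminator, the eliminator is an evaluation position and the step
passes under it; where it asks for reduction to a value, the step is prepended. -/
theorem of_step {A : Ty 0} {i : ℕ} {a : A.D.obj i} {t t' : Pure [] A} (s : Step t t')
    (h : Realizes A i a t') : Realizes A i a t := by
  revert a t t'
  induction A, i using Ty.stage_induction with
  | nat i => 
    intro a t t' s h
    rw [Realizes] at h ⊢
    exact .head s h
  | one => intros; rw [Realizes]; trivial
  | prod A B i ihA ihB =>
    intro a t t' s h
    rw [Realizes] at h ⊢
    exact ⟨ihA (.fst s) h.1, ihB (.snd s) h.2⟩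
  | zero => intro a t t' s h; rwa [Realizes] at h ⊢
  | sum A B i ihA ihB =>
    intro a t t' s h
    rw [Realizes] at h ⊢
    refine h.imp ?_ ?_ <;> exact fun ⟨x, w, u, e, r, h⟩ => ⟨x, w, u, e, .head s r, h⟩
  | arr A B i ihA ihB =>
    intro a t t' s h
    rw [Realizes] at h ⊢
    exact fun j hj x u hu => ihB j hj (.app _ s) (h j hj x u hu)
  | mu A i ih =>
    intro a t t' s h
    rw [Realizes] at h ⊢
    exact fun w => ih w (.unfold w rfl s) (h w)
  | later_zero => intros; rw [Realizes]; trivial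
  | later_succ A i ih =>
    intro a t t' s h
    rw [Realizes] at h ⊢
    obtain ⟨u, r, h⟩ := h
    exact ⟨u, .head s r, h⟩
  | box A i ih =>
    intro a t t' s h
    rw [Realizes] at h ⊢
    exact fun j => ih j (.unbox s) (h j)

theorem of_steps {A : Ty 0} {i : ℕ} {a : A.D.obj i} {t t' : Pure [] A} (s : Steps t t')
    (h : Realizes A i a t') : Realizes A i a t := by
  induction s using Relation.ReflTransGen.head_induction_on with
  | refl => exact h
  | head s _ ih => exact ih.of_step s

/-- Monotonicity in the stage. The function clause already speaks of all earlier stages, the `box`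
clause does not mention the stage, and recursive types use naturality of the unfolding. -/
theorem res {A : Ty 0} {i : ℕ} {a : A.D.obj (i + 1)} {t : Pure [] A}
    (h : Realizes A (i + 1) a t) : Realizes A i (A.D.res i a) t := by
  revert a t
  induction A, i using Ty.stage_induction with
  | nat i => 
    intro a t h
    rw [Realizes] at h ⊢
    exact h
  | one => intros; rw [Realizes]; trivial
  | prod A B i ihA ihB =>
    intro a t h
    rw [Realizes] at h ⊢
    exact ⟨ihA h.1, ihB h.2⟩
  | zero => intro a t h; rw [Realizes] at h; exact h.elim
  | sum A B i ihA ihB =>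
    intro a t h
    rw [Realizes] at h ⊢
    refine h.imp ?_ ?_
    · rintro ⟨x, w, u, e, r, h⟩
      exact ⟨A.D.res i x, w, u, by simp only [e]; rfl, r, ihA h⟩
    · rintro ⟨x, w, u, e, r, h⟩
      exact ⟨B.D.res i x, w, u, by simp only [e]; rfl, r, ihB h⟩
  | arr A B i ihA ihB =>
    intro a t h
    rw [Realizes] at h ⊢
    exact fun j hj x u hu => h j (Nat.le_succ_of_le hj) x u hu
  | mu A i ih =>
    intro a t h
    rw [Realizes] at h ⊢
    intro w
    rw [← (Ty.unfoldHom w).naturality]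
    exact ih w (h w)
  | later_zero => intros; rw [Realizes]; trivial
  | later_succ A i ih =>
    intro a t h
    rw [Realizes] at h ⊢
    obtain ⟨u, r, h⟩ := h
    exact ⟨u, r, ih h⟩
  | box A i ih =>
    intro a t h
    rw [Realizes] at h ⊢
    exact h

theorem restr {A : Ty 0} {i j : ℕ} (hj : j ≤ i) {a : A.D.obj i} {t : Pure [] A}
    (h : Realizes A i a t) : Realizes A j (A.D.restr hj a) t := by
  induction i, hj using Nat.le_induction with
  | base => rwa [Tree.restr_self]
  | succ i hj ih => rw [Tree.restr_succ _ hj]; exact ih h.res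

/-- At a constant type, realizability does not depend on the stage. -/
theorem const_iff {A : Ty 0} (w : A.WF) (c : A.Constant) (x : A.D.Glob) (i : ℕ) (t : Pure [] A) :
    Realizes A i (x.1 i) t ↔ Realizes A 0 (x.1 0) t := by
  -- The size alone suffices as a measure: a constant type has no `later` outside `box`, and at
  -- `box` the clause is literally the same at all stages, so there is no recursion into it.
  induction h : A.unguardedSize using Nat.strong_induction_on generalizing A i with
  | _ n ih =>
  subst h
  cases A with
  | var i => exact i.elim0
  | nat =>
    have e : x.1 i = x.1 0 := by
      induction i with
      | zero => rfl
      | succ i ih => exact (x.2 i).trans ih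
    simp only [Realizes]
    exact iff_of_eq (congrArg (fun n => Steps t (numeral n)) e)
  | one => rw [Realizes, Realizes]
  | zero => rw [Realizes, Realizes]
  | prod A B =>
    let y : A.D.Glob := ⟨fun i => (x.1 i).1, fun i => congrArg Prod.fst (x.2 i)⟩
    let z : B.D.Glob := ⟨fun i => (x.1 i).2, fun i => congrArg Prod.snd (x.2 i)⟩
    rw [Realizes, Realizes]
    exact and_congr (ih _ (by simp only [Ty.unguardedSize]; omega) w.1 c.1 y i _ rfl)
      (ih _ (by simp only [Ty.unguardedSize]; omega) w.2 c.2 z i _ rfl)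
  | sum A B =>
    obtain ⟨s, hs⟩ := Tree.exists_globSum (X := A.D) (Y := B.D) x
    rw [Realizes, Realizes]
    simp only [hs]
    rcases s with y | y
    · have key := fun u => ih _ (by simp only [Ty.unguardedSize]; omega) w.1 c.1 y i u rfl
      constructor <;> rintro (⟨x, w, u, e, r, h⟩ | ⟨x, w, u, e, r, h⟩) <;> cases e
      · exact Or.inl ⟨_, w, u, rfl, r, (key u).1 h⟩
      · exact Or.inl ⟨_, w, u, rfl, r, (key u).2 h⟩
    · have key := fun u => ih _ (by simp only [Ty.unguardedSize]; omega) w.2 c.2 y i u rfl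
      constructor <;> rintro (⟨x, w, u, e, r, h⟩ | ⟨x, w, u, e, r, h⟩) <;> cases e
      · exact Or.inr ⟨_, w, u, rfl, r, (key u).1 h⟩
      · exact Or.inr ⟨_, w, u, rfl, r, (key u).2 h⟩
  | arr A B =>
    have key : ∀ i j, Realizes (.arr A B) i (x.1 i) t → Realizes (.arr A B) j (x.1 j) t := by
      intro i j h
      rw [Realizes] at h ⊢
      intro k hk a u hu
      -- The domain is constant, so the argument at stage `k` extends to a global element `y` and
      -- can be moved to stage `0`; the values of the function along `y` form a global element `z`
      -- of the codomain, which brings the result back.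
      obtain ⟨y, rfl⟩ := (Ty.D_isConst w.1 c.1).exists_glob k a
      have at_stage : ∀ i j (h : j ≤ i), (x.1 i).1 j h = (x.1 j).1 j le_rfl := by
        intro i j h
        induction i, h using Nat.le_induction with
        | base => rfl
        | succ i h ih => rw [← ih, ← x.2 i]; rfl
      let z : B.D.Glob := ⟨fun j => (x.1 j).1 j le_rfl (y.1 j), fun j => by
        refine ((x.1 (j + 1)).2 j le_rfl _).trans ?_
        refine (congrArg _ (y.2 j)).trans ?_
        exact congrFun (at_stage (j + 1) j (Nat.le_succ j)) _⟩
      have hA := ih A.unguardedSize (by simp only [Ty.unguardedSize]; omega) w.1 c.1 y k u rfl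
      have hB := ih B.unguardedSize (by simp only [Ty.unguardedSize]; omega) w.2 c.2 z k (.app t u)
        rfl
      rw [at_stage]
      refine hB.2 ?_
      have := h 0 (Nat.zero_le i) (y.1 0) u (hA.1 hu)
      rwa [at_stage] at this
    exact ⟨key i 0, key 0 i⟩
  | mu A =>
    rw [Realizes, Realizes]
    refine forall_congr' fun h => ?_
    exact ih _ (Ty.unguardedSize_inst_lt h) (Ty.wf_subst A _ (fun _ => w) w.2)
      (Ty.constant_subst A _ (fun _ => c) c) ((Ty.unfoldHom h).mapGlob x) i _ rfl
  | later A => exact c.elim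
  | box A =>
    have e : x.1 i = x.1 0 := by
      induction i with
      | zero => rfl
      | succ i ih => exact (x.2 i).trans ih
    simp only [Realizes]
    exact iff_of_eq (congrArg (fun y : A.D.Glob => ∀ j, Realizes A j (y.1 j) (.unbox t)) e)

theorem of_const {A : Ty 0} (w : A.WF) (c : A.Constant) {i : ℕ} {a : A.D.obj i} {t : Pure [] A}
    (h : Realizes A i a t) {x : A.D.Glob} (e : x.1 i = a) (j : ℕ) : Realizes A j (x.1 j) t := by
  subst e
  exact (const_iff w c x j t).2 ((const_iff w c x i t).1 h)

end Realizes

/-! ### The fundamental lemma of the relation and adequacy -/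

/-- Reduction beneath a term-former. -/
theorem Steps.map {A B : Ty 0} (f : Pure [] A → Pure [] B) (hf : ∀ t u, Step t u → Step (f t) (f u))
    {t u : Pure [] A} (h : Steps t u) : Steps (f t) (f u) :=
  Relation.ReflTransGen.lift f hf _ _ h

/-- The reduction rule excludes the empty context; there the two sides are equal and no step is
taken. -/
theorem Steps.prev_subst {Δ : List (Ty 0)} {A : Ty 0} (hΔ : ∀ B, Var Δ B → B.WF ∧ B.Constant)
    (t : Pure Δ (.later A)) (σ : ∀ B, Var Δ B → Pure [] B) :
    Steps (.prev hΔ t σ) (.prev nilConst (t.subst σ) nilSubst) := by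
  cases Δ with
  | nil =>
    rw [Tm.subst_closed, show σ = nilSubst from funext fun B => funext fun x => nomatch x]
  | cons B Δ => exact .single (.prev_subst hΔ t σ (List.cons_ne_nil _ _))

theorem Steps.boxSum_subst {Δ : List (Ty 0)} {A B : Ty 0}
    (hΔ : ∀ C, Var Δ C → C.WF ∧ C.Constant) (t : Pure Δ (.sum A B))
    (σ : ∀ C, Var Δ C → Pure [] C) :
    Steps (.boxSum hΔ t σ) (.boxSum nilConst (t.subst σ) nilSubst) := by
  cases Δ with
  | nil =>
    rw [Tm.subst_closed, show σ = nilSubst from funext fun B => funext fun x => nomatch x]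
  | cons B Δ => exact .single (.boxSum_subst hΔ t σ (List.cons_ne_nil _ _))

/-- The denotation of a term of the pure calculus. -/
noncomputable abbrev Tm.pden {Γ : List (Ty 0)} {A : Ty 0} (t : Pure Γ A) : (ctxD Γ).Hom A.D :=
  t.den fun _ c => c.elim

/-- Realizability of environments. -/
def RealizesEnv {Γ : List (Ty 0)} (i : ℕ) (γ : (ctxD Γ).obj i) (σ : ∀ B, Var Γ B → Pure [] B) :
    Prop :=
  ∀ B x, Realizes B i (γ B x) (σ B x)

theorem RealizesEnv.restr {Γ : List (Ty 0)} {i j : ℕ} {γ : (ctxD Γ).obj i}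
    {σ : ∀ B, Var Γ B → Pure [] B} (h : RealizesEnv i γ σ) (hj : j ≤ i) :
    RealizesEnv j ((ctxD Γ).restr hj γ) σ := by
  induction i, hj using Nat.le_induction with
  | base => rwa [Tree.restr_self]
  | succ i hj ih => rw [Tree.restr_succ _ hj]; exact ih fun B x => (h B x).res

theorem RealizesEnv.cons {Γ : List (Ty 0)} {A : Ty 0} {i : ℕ} {γ : (ctxD Γ).obj i}
    {σ : ∀ B, Var Γ B → Pure [] B} (h : RealizesEnv i γ σ) {a : A.D.obj i} {t : Pure [] A}
    (ha : Realizes A i a t) :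
    RealizesEnv (Γ := A :: Γ) i (consEnv γ a) (Tm.consSubst t σ)
  | _, .z => ha
  | _, .s x => h _ x

/-- The reason for restricting explicit substitutions to constant types: an environment realized at
one stage has to serve at the next stage for `prev`, and at all stages for `box`. -/
theorem RealizesEnv.glob {Δ : List (Ty 0)} (hΔ : ∀ B, Var Δ B → B.WF ∧ B.Constant) {i : ℕ}
    {γ : (ctxD Δ).obj i} {σ : ∀ B, Var Δ B → Pure [] B} (h : RealizesEnv i γ σ) (j : ℕ) :
    RealizesEnv j (((ctxD_isConst hΔ).glob i γ).1 j) σ := by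
  intro B x
  let y : B.D.Glob := ⟨fun j => ((ctxD_isConst hΔ).glob i γ).1 j B x, fun j =>
    congrFun (congrFun (((ctxD_isConst hΔ).glob i γ).2 j) B) x⟩
  refine (h B x).of_const (hΔ B x).1 (hΔ B x).2 (x := y) ?_ j
  exact congrFun (congrFun ((ctxD_isConst hΔ).glob_apply i γ) B) x


/-- A recursive type denotes the same object as its unfolding, so `fold` and `unfold` denote
transports, which cancel. -/
theorem Tree.ofEq_ofEq {X Y : Tree} (h : X = Y) (h' : Y = X) (i : ℕ) (x : X.obj i) :
    (Hom.ofEq h').app i ((Hom.ofEq h).app i x) = x := by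
  cases h; rfl

namespace Realizes

theorem app {A B : Ty 0} {i : ℕ} {f : (A.D.exp B.D).obj i} {t : Pure [] (.arr A B)}
    (h : Realizes (.arr A B) i f t) {x : A.D.obj i} {u : Pure [] A} (hx : Realizes A i x u) :
    Realizes B i (f.1 i le_rfl x) (.app t u) :=
  (Realizes.eq_def (.arr A B) i f t).mp h i le_rfl x u hx

theorem inl {A B : Ty 0} {i : ℕ} {s : A.D.obj i ⊕ B.D.obj i} {x : A.D.obj i} (e : s = Sum.inl x)
    {t : Pure [] (.sum A B)} {w : B.WF} {u : Pure [] A} (r : Steps t (.inl w u))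
    (h : Realizes A i x u) : Realizes (.sum A B) i s t :=
  (Realizes.eq_def (.sum A B) i s t).mpr (Or.inl ⟨x, w, u, e, r, h⟩)

theorem inr {A B : Ty 0} {i : ℕ} {s : A.D.obj i ⊕ B.D.obj i} {x : B.D.obj i} (e : s = Sum.inr x)
    {t : Pure [] (.sum A B)} {w : A.WF} {u : Pure [] B} (r : Steps t (.inr w u))
    (h : Realizes B i x u) : Realizes (.sum A B) i s t :=
  (Realizes.eq_def (.sum A B) i s t).mpr (Or.inr ⟨x, w, u, e, r, h⟩)

theorem box {A : Ty 0} {i : ℕ} {x : A.D.Glob} {t : Pure [] (.box A)}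
    (h : ∀ j, Realizes A j (x.1 j) (.unbox t)) : Realizes (.box A) i x t :=
  (Realizes.eq_def (.box A) i x t).mpr h

end Realizes

/-- Every term realizes its denotation. -/
theorem realizes_den {Γ : List (Ty 0)} {A : Ty 0} (t : Pure Γ A) :
    ∀ (i : ℕ) (γ : (ctxD Γ).obj i) (σ : ∀ B, Var Γ B → Pure [] B), RealizesEnv i γ σ →
      Realizes A i (t.pden.app i γ) (t.subst σ) := by
  induction t with
  | atom c => exact c.elim
  | var x => exact fun i γ σ h => h _ x
  | zero => 
    intro i γ σ h
    rw [Realizes]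
    exact .refl
  | succ t ih =>
    intro i γ σ h
    have := ih i γ σ h
    rw [Realizes] at this ⊢
    exact this.map Tm.succ fun _ _ => .succ
  | unit => intros; rw [Realizes]; trivial
  | pair t u iht ihu =>
    intro i γ σ h
    rw [Realizes]
    exact ⟨(iht i γ σ h).of_step (.fst_pair _ _), (ihu i γ σ h).of_step (.snd_pair _ _)⟩
  | fst t ih =>
    intro i γ σ h
    have := ih i γ σ h
    rw [Realizes] at this
    exact this.1
  | snd t ih =>
    intro i γ σ h
    have := ih i γ σ h
    rw [Realizes] at this
    exact this.2
  | abort w t ih =>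
    intro i γ σ h
    have := ih i γ σ h
    rw [Realizes] at this
    exact this.elim
  | inl w t ih =>
    intro i γ σ h
    exact .inl rfl (w := w) .refl (ih i γ σ h)
  | inr w t ih =>
    intro i γ σ h
    exact .inr rfl (w := w) .refl (ih i γ σ h)
  | case t u v iht ihu ihv =>
    intro i γ σ h
    have := iht i γ σ h
    rw [Realizes] at this
    rcases this with ⟨x, w, t', e, r, hx⟩ | ⟨x, w, t', e, r, hx⟩
    · have r' : Steps (Tm.case (t.subst σ) (u.subst (Tm.liftSubst σ _))
          (v.subst (Tm.liftSubst σ _))) (u.subst (Tm.consSubst t' σ)) := by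
        refine (r.map (fun t => Tm.case t _ _) fun _ _ => .case _ _).tail ?_
        rw [← Tm.subst_lift_single]
        exact .case_inl _ _ _ _
      refine Realizes.of_steps r' ?_
      have := ihu i _ _ (h.cons hx)
      refine Eq.mp ?_ this
      congr 1
      simp only [Tm.pden, Tm.den, Tree.Hom.case] at e ⊢
      rw [e]
      rfl
    · have r' : Steps (Tm.case (t.subst σ) (u.subst (Tm.liftSubst σ _))
          (v.subst (Tm.liftSubst σ _))) (v.subst (Tm.consSubst t' σ)) := by
        refine (r.map (fun t => Tm.case t _ _) fun _ _ => .case _ _).tail ?_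
        rw [← Tm.subst_lift_single]
        exact .case_inr _ _ _ _
      refine Realizes.of_steps r' ?_
      have := ihv i _ _ (h.cons hx)
      refine Eq.mp ?_ this
      congr 1
      simp only [Tm.pden, Tm.den, Tree.Hom.case] at e ⊢
      rw [e]
      rfl
  | lam w t ih =>
    intro i γ σ h
    rw [Realizes]
    intro j hj x u hu
    refine Realizes.of_step (.beta w _ u) ?_
    rw [Tm.subst_lift_single]
    exact ih j _ _ ((h.restr hj).cons hu)
  | app t u iht ihu =>
    intro i γ σ h
    have := iht i γ σ h
    rw [Realizes] at this
    exact this i le_rfl _ _ (ihu i γ σ h)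
  | fold w e t ih =>
    intro i γ σ h
    subst e
    rw [Realizes]
    intro w'
    refine Realizes.of_step (.unfold_fold w rfl _) ?_
    have := ih i γ σ h
    refine Eq.mp ?_ this
    congr 1
    exact (Tree.ofEq_ofEq _ _ _ _).symm
  | unfold w e t ih =>
    intro i γ σ h
    subst e
    have := ih i γ σ h
    rw [Realizes] at this
    exact this w
  | next t ih =>
    intro i γ σ h
    cases i with
    | zero => rw [Realizes]; trivial
    | succ i =>
      rw [Realizes]
      -- The content of `next` at stage `i + 1` is only required at stage `i`.
      exact ⟨_, .refl, (ih _ γ σ h).res⟩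
  | prev hΔ t τ iht ihτ =>
    intro i γ σ h
    have hδ : RealizesEnv i ((tupleHom fun B x => (τ B x).pden).app i γ)
        fun B x => (τ B x).subst σ := fun B x => ihτ B x i γ σ h
    -- The body is taken one stage later, so that its clause for `later` yields a reduct at stage
    -- `i`.
    have := iht (i + 1) _ _ (hδ.glob hΔ (i + 1))
    rw [Realizes] at this
    obtain ⟨u, r, hu⟩ := this
    refine Realizes.of_steps ?_ hu
    refine (Steps.prev_subst hΔ t _).trans ?_
    exact (r.map (fun t => Tm.prev nilConst t nilSubst) fun _ _ => .prev).tail (.prev_next u)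
  | ap t u iht ihu =>
    intro i γ σ h
    cases i with
    | zero => rw [Realizes]; trivial
    | succ i =>
      have h1 := iht _ γ σ h
      have h2 := ihu _ γ σ h
      rw [Realizes] at h1 h2 ⊢
      obtain ⟨t', r1, h1⟩ := h1
      obtain ⟨u', r2, h2⟩ := h2
      refine ⟨.app t' u', ?_, h1.app h2⟩
      refine (r1.map (fun t => Tm.ap t _) fun _ _ => .ap_left _).trans ?_
      exact (r2.map (fun u => Tm.ap _ u) fun _ _ => .ap_right (.next t')).tail (.ap_next t' u')
  | box hΔ t τ iht ihτ =>
    intro i γ σ h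
    have hδ : RealizesEnv i ((tupleHom fun B x => (τ B x).pden).app i γ)
        fun B x => (τ B x).subst σ := fun B x => ihτ B x i γ σ h
    rw [Realizes]
    intro j
    exact (iht j _ _ (hδ.glob hΔ j)).of_step (.unbox_box hΔ t _)
  | unbox t ih =>
    intro i γ σ h
    have := ih i γ σ h
    rw [Realizes] at this
    exact this i
  | @boxSum Γ Δ A B hΔ t τ iht ihτ =>
    intro i γ σ h
    have hδ : RealizesEnv i ((tupleHom fun B x => (τ B x).pden).app i γ)
        fun B x => (τ B x).subst σ := fun B x => ihτ B x i γ σ h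
    have key := fun j => iht j _ _ (hδ.glob hΔ j)
    simp only [Realizes] at key
    set x : (A.D.sum B.D).Glob := t.pden.mapGlob
      ((ctxD_isConst hΔ).glob i ((tupleHom fun B x => (τ B x).pden).app i γ)) with hx
    change ∀ j, (∃ a h u, x.1 j = Sum.inl a ∧ _ ∧ _) ∨ ∃ b h u, x.1 j = Sum.inr b ∧ _ ∧ _ at key
    have e := (Tree.exists_globSum x).choose_spec
    change ∀ j, x.1 j = Sum.map (fun a => a.1 j) (fun b => b.1 j) (Tree.globSum x) at e
    have er : ((Tm.boxSum hΔ t τ).pden.app i γ) = Tree.globSum x := rfl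
    refine Realizes.of_steps (Steps.boxSum_subst hΔ t _) ?_
    rcases hs : Tree.globSum x with a | b
    · rw [hs] at e
      have key' : ∀ j, ∃ w u, Steps (t.subst fun B x => (τ B x).subst σ) (.inl w u) ∧
          Realizes A j (a.1 j) u := by
        intro j
        rcases key j with ⟨a', w, u, e', r, h⟩ | ⟨b', w, u, e', r, h⟩
        · rw [e j] at e'
          cases e'
          exact ⟨w, u, r, h⟩
        · rw [e j] at e'
          cases e'
      -- Stage `0` serves to name the reduct; any stage would do, since `globSum` has fixed the
      -- summand for all of them.
      obtain ⟨w, u, r, -⟩ := key' 0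
      refine .inl (er.trans hs) (w := w) (u := .box nilConst u nilSubst) ?_ ?_
      · exact (r.map (fun t => Tm.boxSum nilConst t nilSubst) fun _ _ => .boxSum).tail
          (.boxSum_inl w w u)
      · refine .box fun j => ?_
        obtain ⟨w', u', r', hu'⟩ := key' j
        -- Each stage provides its own reduct; determinism identifies it with `u`, so the single
        -- term `u` realizes all components of `a`.
        cases IsValue.eq_of_reduces (.inl w u) (.inl w' u') r r'
        refine Realizes.of_step (.unbox_box nilConst u nilSubst) ?_
        rw [Tm.subst_closed]
        exact hu'
    · rw [hs] at e
      have key' : ∀ j, ∃ w u, Steps (t.subst fun B x => (τ B x).subst σ) (.inr w u) ∧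
          Realizes B j (b.1 j) u := by
        intro j
        rcases key j with ⟨a', w, u, e', r, h⟩ | ⟨b', w, u, e', r, h⟩
        · rw [e j] at e'
          cases e'
        · rw [e j] at e'
          cases e'
          exact ⟨w, u, r, h⟩
      obtain ⟨w, u, r, -⟩ := key' 0
      refine .inr (er.trans hs) (w := w) (u := .box nilConst u nilSubst) ?_ ?_
      · exact (r.map (fun t => Tm.boxSum nilConst t nilSubst) fun _ _ => .boxSum).tail
          (.boxSum_inr w w u)
      · refine .box fun j => ?_
        obtain ⟨w', u', r', hu'⟩ := key' j
        cases IsValue.eq_of_reduces (.inr w u) (.inr w' u') r r'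
        refine Realizes.of_step (.unbox_box nilConst u nilSubst) ?_
        rw [Tm.subst_closed]
        exact hu'

/-- Computational adequacy: closed terms of type `nat` reduce to the numeral they denote. -/
theorem steps_numeral (t : Pure [] .nat) (γ : (ctxD []).obj 0) :
    Steps t (numeral (t.pden.app 0 γ)) := by
  have h := realizes_den t 0 γ nilSubst fun B x => nomatch x
  rwa [Tm.subst_closed, Realizes] at h


/-! ### Compositionality of the denotation -/

/-- The arrow between contexts given by a renaming. -/
def renHom {Γ Δ : List (Ty 0)} (r : ∀ B, Var Γ B → Var Δ B) : (ctxD Δ).Hom (ctxD Γ) :=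
  ⟨fun _ δ B x => δ B (r B x), fun _ _ => rfl⟩

theorem renHom_consEnv {Γ Δ : List (Ty 0)} (r : ∀ B, Var Γ B → Var Δ B) {A : Ty 0} {i : ℕ}
    (δ : (ctxD Δ).obj i) (a : A.D.obj i) :
    (renHom (Var.lift r A)).app i (consEnv δ a) = consEnv ((renHom r).app i δ) a := by
  funext B x
  cases x <;> rfl

namespace Tree.Hom

/-- Abstraction evaluates its body in restricted environments, and arrows commute with restriction.
-/
theorem curry_comp {X X' Y Z : Tree} (f : (X.prod Y).Hom Z) (g : X'.Hom X)
    (f' : (X'.prod Y).Hom Z) (h : ∀ i x y, f'.app i (x, y) = f.app i (g.app i x, y)) :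
    f'.curry = f.curry.comp g := by
  ext i x
  apply Subtype.ext
  funext j hj y
  exact (h j _ y).trans (congrArg (fun a => f.app j (a, y)) (g.app_restr hj x).symm)

end Tree.Hom

theorem Tm.den_rename {S : Ty 0 → Type} (I : ∀ A, S A → A.D.Glob) {Γ : List (Ty 0)} {A : Ty 0}
    (t : Term S Γ A) : ∀ {Δ : List (Ty 0)} (r : ∀ B, Var Γ B → Var Δ B),
      (t.rename r).den I = (t.den I).comp (renHom r) := by
  induction t with
  | case t u v iht ihu ihv =>
    intro Δ r
    simp only [rename, den, iht, ihu, ihv]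
    ext i δ
    simp only [Tree.Hom.case, Tree.Hom.comp, ctxCons, renHom_consEnv]
  | lam w t ih =>
    intro Δ r
    simp only [rename, den, ih]
    refine Tree.Hom.curry_comp _ _ _ fun i x y => ?_
    simp only [Tree.Hom.comp, ctxCons, renHom_consEnv]
  | ap t u iht ihu =>
    intro Δ r
    simp only [rename, den, iht, ihu]
    -- `ap` is defined by cases on the stage, so it computes only after the stage is split.
    ext (_ | i) δ <;> rfl
  | prev hΔ t σ iht ihσ | box hΔ t σ iht ihσ | boxSum hΔ t σ iht ihσ =>
    intro Δ r
    simp only [rename, den, ihσ]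
    rfl
  | _ =>
    intros
    simp only [rename, den, *]
    try rfl

/-- Serves to replace symbols by implementations: the atoms have an interpretation, and the terms
put for them denote it. -/
theorem Tm.den_bindAtoms {S S' : Ty 0 → Type} (I : ∀ A, S A → A.D.Glob)
    (I' : ∀ A, S' A → A.D.Glob) (φ : ∀ Γ A, S A → Term S' Γ A)
    (hφ : ∀ Γ A c, (φ Γ A c).den I' = (Tm.atom c : Term S Γ A).den I) {Γ : List (Ty 0)} {A : Ty 0}
    (t : Term S Γ A) : Tm.den I' (Tm.bindAtoms φ t) = t.den I := by
  induction t with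
  | atom c => exact hφ _ _ c
  | _ => simp only [bindAtoms, den, *] <;> rfl

/-- Serves to fill contexts: holes have no interpretation of their own, so two fillings are compared
with each other. -/
theorem Tm.den_bindAtoms_congr {K : List (Ty 0) → Ty 0 → Type} {S : Ty 0 → Type}
    (I : ∀ A, S A → A.D.Glob) (φ ψ : ∀ Γ A, K Γ A → Term S Γ A)
    (h : ∀ Γ A c, (φ Γ A c).den I = (ψ Γ A c).den I) {Γ : List (Ty 0)} {A : Ty 0}
    (t : Tm K Γ A) : Tm.den I (t.bindAtoms φ) = Tm.den I (t.bindAtoms ψ) := by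
  induction t with
  | atom c => exact h _ _ c
  | _ => simp only [bindAtoms, den, *] <;> rfl

/-- Terms with equal denotations are contextually equivalent. -/
theorem ctxEq_of_den_eq {Γ : List (Ty 0)} {A : Ty 0} {t u : Pure Γ A} (h : t.pden = u.pden) :
    CtxEq t u := by
  intro C
  have e : (C.fill t).pden = (C.fill u).pden :=
    Tm.den_bindAtoms_congr _ _ _ (fun Γ A c => by cases c; exact h) C
  refine ⟨_, numeral_isValue _, steps_numeral (C.fill t) (fun B x => nomatch x), ?_⟩
  rw [e]
  exact steps_numeral _ _

/-! ### Implementations as interpretations -/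

/-- The empty environment. -/
def emptyEnv : (ctxD []).Glob :=
  ⟨fun _ _ x => (nomatch x), fun _ => funext fun _ => funext fun x => (nomatch x)⟩

theorem env_nil_eq {i : ℕ} (γ δ : (ctxD []).obj i) : γ = δ :=
  funext fun _ => funext fun x => nomatch x

/-- The interpretation of function symbols by the denotations of their implementations. -/
noncomputable def Impl.glob {Sg : Sig} (E : Impl Sg) : ∀ A, Sym Sg A → A.D.Glob
  | _, .mk g => (E g).pden.mapGlob emptyEnv

theorem Impl.den_inst {Sg : Sig} (E : Impl Sg) {Γ : List (Ty 0)} {A : Ty 0}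
    (t : Term (Sym Sg) Γ A) : (E.inst t).pden = t.den E.glob := by
  refine Tm.den_bindAtoms _ _ _ (fun Γ A c => ?_) t
  cases c with
  | mk g =>
    change ((E g).rename _).den _ = _
    rw [Tm.den_rename]
    ext i γ
    change (E g).pden.app i _ = (E g).pden.app i _
    exact congrArg _ (env_nil_eq _ _)

/-- The bridge from the equations in the model to contextual equivalence: `E.glob` is an admissible
assignment of global elements to the symbols. -/
theorem Impl.eq_of_den_eq {Sg : Sig} (E : Impl Sg) {Γ : List (Ty 0)} {A : Ty 0}
    {t u : Term (Sym Sg) Γ A} (h : t.den E.glob = u.den E.glob) : E.Eq t u := by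
  apply ctxEq_of_den_eq
  rw [E.den_inst, E.den_inst, h]


/-! ### Calculating denotations -/

namespace Tree

theorem restr_const {Z : Type} {i j : ℕ} (h : j ≤ i) (z : Z) : (const Z).restr h z = z := by
  induction i, h using Nat.le_induction with
  | base => exact restr_self _ _
  | succ i h ih => exact (restr_succ (const Z) h z).trans ih

theorem Glob.const_eq {Z : Type} (x : (const Z).Glob) (i j : ℕ) : x.1 i = x.1 j := by
  have h : ∀ i, x.1 i = x.1 0 := by
    intro i
    induction i with
    | zero => rfl
    | succ i ih => exact (x.2 i).trans ih
  rw [h i, h j]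

theorem exp_restr {X Y : Tree} {i j k : ℕ} (h : j ≤ i) (h' : k ≤ j) (f : (X.exp Y).obj i) :
    ((X.exp Y).restr h f).1 k h' = f.1 k (h'.trans h) := by
  induction i, h using Nat.le_induction with
  | base => rw [restr_self]
  | succ i h ih => rw [restr_succ _ h, ih]; rfl

end Tree

theorem ctxD_restr {Γ : List (Ty 0)} {i j : ℕ} (h : j ≤ i) (γ : (ctxD Γ).obj i) (B : Ty 0)
    (x : Var Γ B) : (ctxD Γ).restr h γ B x = B.D.restr h (γ B x) := by
  induction i, h using Nat.le_induction with
  | base => rw [Tree.restr_self, Tree.restr_self]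
  | succ i h ih => rw [Tree.restr_succ _ h, Tree.restr_succ _ h, ih]; rfl

/-- Application of an element of a function type at an earlier stage. -/
def fap {A B : Ty 0} {i j : ℕ} (h : j ≤ i) (f : (Ty.arr A B).D.obj i) (a : A.D.obj j) :
    B.D.obj j :=
  let f : (A.D.exp B.D).obj i := f
  f.1 j h a

theorem fap_ext {A B : Ty 0} {i : ℕ} {f g : (Ty.arr A B).D.obj i}
    (h : ∀ j (hj : j ≤ i) a, fap hj f a = fap hj g a) : f = g :=
  Subtype.ext (funext fun j => funext fun hj => funext fun a => h j hj a)

theorem fap_restr {A B : Ty 0} {i j : ℕ} (h : j ≤ i) (f : (Ty.arr A B).D.obj i) (a : A.D.obj j) :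
    fap le_rfl ((Ty.arr A B).D.restr h f) a = fap h f a :=
  congrFun (Tree.exp_restr h le_rfl f) a

section

variable {S : Ty 0 → Type} (I : ∀ A, S A → A.D.Glob) {Γ : List (Ty 0)}

theorem den_app {A B : Ty 0} (t : Term S Γ (.arr A B)) (u : Term S Γ A) (i : ℕ)
    (γ : (ctxD Γ).obj i) : (Tm.den I (.app t u)).app i γ =
      fap le_rfl ((t.den I).app i γ) ((u.den I).app i γ) := rfl

theorem fap_lam {A B : Ty 0} (w : A.WF) (t : Term S (A :: Γ) B) {i j : ℕ} (h : j ≤ i)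
    (γ : (ctxD Γ).obj i) (a : A.D.obj j) :
    fap h ((Tm.den I (.lam w t)).app i γ) a =
      (t.den I).app j (consEnv ((ctxD Γ).restr h γ) a) := rfl

theorem fap_lam_self {A B : Ty 0} (w : A.WF) (t : Term S (A :: Γ) B) {i : ℕ}
    (γ : (ctxD Γ).obj i) (a : A.D.obj i) :
    fap le_rfl ((Tm.den I (.lam w t)).app i γ) a = (t.den I).app i (consEnv γ a) := by
  rw [fap_lam, Tree.restr_self]

theorem den_next_succ {A : Ty 0} (t : Term S Γ A) (i : ℕ) (γ : (ctxD Γ).obj (i + 1)) :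
    (Tm.den I (.next t)).app (i + 1) γ = (t.den I).app i ((ctxD Γ).res i γ) :=
  (t.den I).naturality i γ

theorem den_ap_succ {A B : Ty 0} (t : Term S Γ (.later (.arr A B))) (u : Term S Γ (.later A))
    (i : ℕ) (γ : (ctxD Γ).obj (i + 1)) : (Tm.den I (.ap t u)).app (i + 1) γ =
      fap (A := A) (B := B) (le_refl i) ((t.den I).app (i + 1) γ) ((u.den I).app (i + 1) γ) := rfl

/-! #### The fixed point combinator -/

theorem fap_thetaTm_zero {A : Ty 0} (hA : A.WF) (γ : (ctxD Γ).obj 0)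
    (y : (Ty.later (.mu (recBody A))).D.obj 0) (f : (Ty.arr (.later A) A).D.obj 0) :
    fap le_rfl (fap le_rfl (((thetaTm (S := S) hA).den I).app 0 γ) y) f =
      fap (A := .later A) (B := A) (le_refl 0) f () := by
  refine (congrArg (fun g => fap (le_refl 0) g f) (fap_lam_self I _ _ γ y)).trans ?_
  exact fap_lam_self I _ _ _ f

/-- At stage `i + 1` the body of `θ` passes to `f` the self-application of `y`, computed at stage
`i`. -/
theorem fap_thetaTm_succ {A : Ty 0} (hA : A.WF) (i : ℕ) (γ : (ctxD Γ).obj (i + 1))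
    (y : (Ty.mu (recBody A)).D.obj i) (f : (Ty.arr (.later A) A).D.obj (i + 1)) :
    fap (A := .arr (.later A) A) (B := A) (le_refl (i + 1)) (fap (A := .later (.mu (recBody A)))
      (le_refl (i + 1)) (((thetaTm (S := S) hA).den I).app (i + 1) γ) y) f =
      fap (A := .later A) (B := A) (le_refl (i + 1)) f
        (fap (A := .arr (.later A) A) (B := A) (le_refl i) (fap (A := .later (.mu (recBody A)))
          (B := .arr (.arr (.later A) A) A) (le_refl i)
          ((Tree.Hom.ofEq (by rw [recBody_inst]; exact (Ty.D_inst (recBody_wf hA)).symm)).app i y)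
          ((Ty.later (.mu (recBody A))).D.res i y)) ((Ty.arr (.later A) A).D.res i f)) := by
  refine (congrArg (fun g => fap (A := .arr (.later A) A) (B := A) (le_refl (i + 1)) g f)
    (fap_lam_self I (A := .later (.mu (recBody A))) _ _ γ y)).trans ?_
  exact fap_lam_self I _ _ _ f

/-- One unrolling of `θ`, without induction. Its argument `next (fold θ)` has at stage `i + 1` the
value of `fold θ` at stage `i`; the `unfold` in `θ` cancels the `fold`, and what is passed to `t` is
again the fixed point, one stage earlier. -/
theorem den_fix {A : Ty 0} (hA : A.WF) (t : Term S Γ (.arr (.later A) A)) (i : ℕ)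
    (γ : (ctxD Γ).obj i) : (Tm.den I (.app (fixTm hA) t)).app i γ =
      (Tm.den I (.app t (.next (.app (fixTm hA) t)))).app i γ := by
  cases i with
  | zero => exact fap_thetaTm_zero I hA γ _ _
  | succ i =>
    refine (fap_thetaTm_succ I hA i γ _ _).trans ?_
    refine congrArg (fap (A := .later A) (B := A) (le_refl (i + 1)) ((t.den I).app (i + 1) γ)) ?_
    refine Eq.trans ?_ (den_next_succ I _ i γ).symm
    refine Eq.trans ?_ (den_app I (fixTm hA) t i _).symm
    refine congrArg₂ (fun g f => fap (A := .arr (.later A) A) (B := A) (le_refl i) g f) ?_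
      ((t.den I).naturality i γ)
    refine Eq.trans ?_ (den_app I (thetaTm hA) _ i _).symm
    have e := (Tm.den I (Tm.fold (recBody_wf hA) (recBody_inst A)
      (thetaTm (S := S) (Γ := Γ) hA))).naturality i γ
    refine congrArg₂ (fun g y => fap (A := .later (.mu (recBody A)))
      (B := .arr (.arr (.later A) A) A) (le_refl i) g y) ?_ ?_
    · refine (congrArg _ e).trans ?_
      exact Tree.ofEq_ofEq _ _ _ _
    · exact (Tm.den I (Tm.next (Tm.fold (recBody_wf hA) (recBody_inst A)
        (thetaTm (S := S) (Γ := Γ) hA)))).naturality i γ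

/-- Induction on the stage: `next u` carries no information at stage `0`, and at stage `i + 1` only
that of `u` at stage `i`. -/
theorem fix_unique {A : Ty 0} (hA : A.WF) (t : Term S Γ (.arr (.later A) A)) (u : Term S Γ A)
    (hu : Tm.den I (.app t (.next u)) = u.den I) : u.den I = Tm.den I (.app (fixTm hA) t) := by
  ext i γ
  induction i with
  | zero =>
    rw [den_fix, ← hu]
    rfl
  | succ i ih =>
    rw [den_fix, ← hu, den_app, den_app, den_next_succ, den_next_succ, ih]

end


/-! #### Streams -/

/-- The object of guarded streams is a fixed point. -/
theorem gStr_D : gStr.D = (Ty.prod .nat (.later gStr)).D :=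
  (Ty.D_inst (A := .prod .nat (.later (.var 0))) gStr_wf).symm

/-- The unfolding of guarded streams. -/
noncomputable def gUnfold : gStr.D.Hom ((Tree.const ℕ).prod gStr.D.later) := Tree.Hom.ofEq gStr_D

/-- Head of a guarded stream. -/
noncomputable def gHd : gStr.D.Hom (Tree.const ℕ) :=
  Tree.Hom.comp (Y := (Tree.const ℕ).prod gStr.D.later) ⟨fun _ => Prod.fst, fun _ _ => rfl⟩ gUnfold

/-- Tail of a guarded stream. -/
noncomputable def gTl : gStr.D.Hom gStr.D.later :=
  Tree.Hom.comp (Y := (Tree.const ℕ).prod gStr.D.later) ⟨fun _ => Prod.snd, fun _ _ => rfl⟩ gUnfold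

/-- Construction of a guarded stream. -/
noncomputable def gCons : ((Tree.const ℕ).prod gStr.D.later).Hom gStr.D := Tree.Hom.ofEq gStr_D.symm

theorem gHd_gCons (i : ℕ) (n : ℕ) (s : gStr.D.later.obj i) : gHd.app i (gCons.app i (n, s)) = n :=
  congrArg Prod.fst (Tree.ofEq_ofEq gStr_D.symm gStr_D i (n, s))

theorem gTl_gCons (i : ℕ) (n : ℕ) (s : gStr.D.later.obj i) : gTl.app i (gCons.app i (n, s)) = s :=
  congrArg Prod.snd (Tree.ofEq_ofEq gStr_D.symm gStr_D i (n, s))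

theorem gCons_eta (i : ℕ) (s : gStr.D.obj i) : gCons.app i (gHd.app i s, gTl.app i s) = s :=
  Tree.ofEq_ofEq gStr_D gStr_D.symm i s

/-- The head of a global stream is the same at all stages. -/
theorem gHd_glob (s : gStr.D.Glob) (i j : ℕ) : gHd.app i (s.1 i) = gHd.app j (s.1 j) :=
  Tree.Glob.const_eq (gHd.mapGlob s) i j

section

variable {S : Ty 0 → Type} (I : ∀ A, S A → A.D.Glob) {Γ : List (Ty 0)}

theorem den_beta {A B : Ty 0} (w : A.WF) (t : Term S (A :: Γ) B) (u : Term S Γ A) (i : ℕ)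
    (γ : (ctxD Γ).obj i) : (Tm.den I (.app (.lam w t) u)).app i γ =
      (t.den I).app i (consEnv γ ((u.den I).app i γ)) :=
  fap_lam_self I w t γ _

theorem den_gcons (n : Term S Γ .nat) (s : Term S Γ (.later gStr)) (i : ℕ) (γ : (ctxD Γ).obj i) :
    ((gcons n s).den I).app i γ = gCons.app i ((n.den I).app i γ, (s.den I).app i γ) := by
  refine congrArg (fun m => gCons.app i (m, (s.den I).app i γ)) ?_
  exact congrFun (congrFun (Tree.restr_self (ctxD (.nat :: Γ)) _) _) _

/-- The element of the denotation of a type `box A`. -/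
def globOf {A : Ty 0} {i : ℕ} (x : (Ty.box A).D.obj i) : A.D.Glob := x

/-- A variable keeps its value when the environment is moved to another stage, if the type of the
variable denotes a constant object on the nose. -/
theorem glob_var {Δ : List (Ty 0)} (h : (ctxD Δ).IsConst) {B : Ty 0} {Z : Type}
    (f : B.D.Hom (Tree.const Z)) (x : Var Δ B) (i j : ℕ) (δ : (ctxD Δ).obj i) :
    f.app j ((h.glob i δ).1 j B x) = f.app i (δ B x) := by
  let y : B.D.Glob := ⟨fun j => (h.glob i δ).1 j B x, fun j =>
    congrFun (congrFun ((h.glob i δ).2 j) B) x⟩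
  refine (Tree.Glob.const_eq (f.mapGlob y) j i).trans ?_
  exact congrArg (f.app i) (congrFun (congrFun (h.glob_apply i δ) B) x)

/-- The identity arrow. -/
def Tree.Hom.id (X : Tree) : X.Hom X := ⟨fun _ x => x, fun _ _ => rfl⟩

/-- The part of an environment that belongs to the first variables. -/
def takeEnv (Δ : List (Ty 0)) {i : ℕ} (γ : (ctxD (Δ ++ Γ)).obj i) : (ctxD Δ).obj i :=
  fun B x => γ B (Var.appendRight Γ B x)

theorem den_boxIota {Δ : List (Ty 0)} (hΔ : ∀ B, Var Δ B → B.WF ∧ B.Constant) {A : Ty 0}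
    (t : Term S Δ A) (i j : ℕ) (γ : (ctxD (Δ ++ Γ)).obj i) :
    (globOf (((boxIota (Γ := Γ) Δ hΔ t).den I).app i γ)).1 j =
      (t.den I).app j (((ctxD_isConst hΔ).glob i (takeEnv Δ γ)).1 j) := rfl

/-- The body of `box` is evaluated at stage `j` and that of `prev` at stage `j + 1`. Each has its
own explicit substitution, hence the two transports `e1` and `e2` of the same stream. -/
theorem den_ctl (s : Term S Γ cStr) (i j : ℕ) (γ : (ctxD Γ).obj i) :
    (globOf (((ctl s).den I).app i γ)).1 j =
      gTl.app (j + 1) ((globOf ((s.den I).app i γ)).1 (j + 1)) := by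
  refine (congrArg (fun x => (globOf (A := gStr) (i := i) x).1 j)
    (den_beta I (A := cStr) (B := cStr) _ _ s i γ)).trans ?_
  have h := ctxD_isConst (cons_const cStr_wf cStr_const nilConst)
  let δ : (ctxD (cStr :: Γ)).obj i := consEnv γ ((s.den I).app i γ)
  have e1 := glob_var h (B := cStr) (Tree.Hom.id _) .z i j (takeEnv [cStr] δ)
  have e2 := glob_var h (B := cStr) (Tree.Hom.id _) .z j (j + 1)
    (takeEnv (Γ := []) [cStr] ((h.glob i (takeEnv [cStr] δ)).1 j))
  exact congrArg (fun x => gTl.app (j + 1) ((globOf (A := gStr) (i := i) x).1 (j + 1)))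
    (e2.trans e1)

theorem den_ccons (n : Term S Γ .nat) (s : Term S Γ cStr) (i j : ℕ) (γ : (ctxD Γ).obj i) :
    (globOf (((ccons n s).den I).app i γ)).1 j =
      gCons.app j ((n.den I).app i γ, (Tree.Hom.next gStr.D).app j
        ((globOf ((s.den I).app i γ)).1 j)) := by
  refine (congrArg (fun x => (globOf (A := gStr) (i := i) x).1 j)
    (den_app I (A := cStr) (B := cStr) (.app consTm n) s i γ)).trans ?_
  refine (congrArg (fun f => (globOf (A := gStr) (i := i)
    (fap (A := cStr) (B := cStr) le_rfl f ((s.den I).app i γ))).1 j)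
    (den_beta I (A := .nat) (B := .arr cStr cStr) _ _ n i γ)).trans ?_
  refine (congrArg (fun x => (globOf (A := gStr) (i := i) x).1 j)
    (fap_lam_self I (A := cStr) (B := cStr) _ _ _ ((s.den I).app i γ))).trans ?_
  have h := ctxD_isConst (cons_const cStr_wf cStr_const
    (cons_const (A := .nat) trivial trivial nilConst))
  let δ : (ctxD (cStr :: .nat :: Γ)).obj i :=
    consEnv (consEnv γ ((n.den I).app i γ)) ((s.den I).app i γ)
  have e1 := glob_var h (B := .nat) (Tree.Hom.id _) (.s .z) i j (takeEnv [cStr, .nat] δ)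
  have e2 := glob_var h (B := cStr) (Tree.Hom.id _) .z i j (takeEnv [cStr, .nat] δ)
  refine (den_boxIota (Γ := Γ) (Δ := [cStr, .nat]) I _ _ i j δ).trans
    ((den_gcons I _ _ _ _).trans ?_)
  exact congrArg₂ (fun n x => gCons.app j (n, (Tree.Hom.next gStr.D).app j
    ((globOf (A := gStr) (i := i) x).1 j))) e1 e2

/-! #### Sorts -/

/-- The element at stage `j` of the guarded type given by an element of the coinductive type. -/
def down : (s : Srt) → {i : ℕ} → (j : ℕ) → (cty s).D.obj i → (gty s).D.obj j
  | .base, _, _, n => n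
  | .str, _, j, x => (globOf x).1 j

/-- The arrow underlying `down`. -/
def downHom (s : Srt) (j : ℕ) : (cty s).D.Hom (Tree.const ((gty s).D.obj j)) :=
  ⟨fun _ a => down s j a, fun _ _ => by cases s <;> rfl⟩

theorem den_unlift (s : Srt) (t : Term S Γ (cty s)) (i : ℕ) (γ : (ctxD Γ).obj i) :
    ((unlift s t).den I).app i γ = down s i ((t.den I).app i γ) := by
  cases s <;> rfl

/-- At the base sort `unbox` reads stage `i` rather than `j`, which does not matter for a global
number. -/
theorem down_den_relift (s : Srt) (t : Term S Γ (.box (gty s))) (i j : ℕ) (γ : (ctxD Γ).obj i) :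
    down s j (((relift s t).den I).app i γ) = (globOf ((t.den I).app i γ)).1 j := by
  cases s with
  | base => exact Tree.Glob.const_eq (globOf ((t.den I).app i γ)) i j
  | str => rfl

/-- The projections of a product. -/
noncomputable def projHom (T : Srt → Ty 0) : (n : ℕ) → (s : Fin n → Srt) → (p : Fin n) →
    (prodTy T n s).D.Hom (T (s p)).D
  | n + 1, s, p =>
    Fin.cases (motive := fun p => (prodTy T (n + 1) s).D.Hom (T (s p)).D)
      (⟨fun _ => Prod.fst, fun _ _ => rfl⟩ : ((T (s 0)).D.prod (prodTy T n _).D).Hom _)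
      (fun p => Tree.Hom.comp (projHom T n (fun i => s i.succ) p)
        (⟨fun _ => Prod.snd, fun _ _ => rfl⟩ :
          ((T (s 0)).D.prod (prodTy T n fun i => s i.succ).D).Hom _)) p

/-- The tuple of a family of elements. -/
def tupleD {T : Srt → Ty 0} {i : ℕ} : (n : ℕ) → (s : Fin n → Srt) → (∀ p, (T (s p)).D.obj i) →
    (prodTy T n s).D.obj i
  | 0, _, _ => ()
  | n + 1, _, a => (a 0, tupleD n _ fun p => a p.succ)

theorem projHom_tupleD {T : Srt → Ty 0} {i : ℕ} (n : ℕ) (s : Fin n → Srt)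
    (a : ∀ p, (T (s p)).D.obj i) (p : Fin n) :
    (projHom T n s p).app i (tupleD n s a) = a p := by
  induction n with
  | zero => exact p.elim0
  | succ n ih =>
    refine Fin.cases rfl (fun p => ?_) p
    exact ih _ (fun p => a p.succ) p

theorem den_tuple {T : Srt → Ty 0} (n : ℕ) (s : Fin n → Srt) (a : ∀ p, Term S Γ (T (s p)))
    (i : ℕ) (γ : (ctxD Γ).obj i) :
    ((tuple n s a).den I).app i γ = tupleD n s fun p => ((a p).den I).app i γ := by
  induction n with
  | zero => rfl
  | succ n ih => exact congrArg (Prod.mk _) (ih _ fun p => a p.succ)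

theorem den_proj {T : Srt → Ty 0} (n : ℕ) (s : Fin n → Srt) (t : Term S Γ (prodTy T n s))
    (p : Fin n) (i : ℕ) (γ : (ctxD Γ).obj i) :
    ((proj n s t p).den I).app i γ = (projHom T n s p).app i ((t.den I).app i γ) := by
  induction n with
  | zero => exact p.elim0
  | succ n ih =>
    refine Fin.cases rfl (fun p => ?_) p
    exact ih _ (.snd t) p

/-! #### Lifting -/

/-- `box` evaluates its body at every stage `j` in an environment of constant types. The stages `i`
and `l` at which the lifted function is formed and applied therefore leave no trace on the right. -/
theorem down_limit {n : ℕ} {s : Fin n → Srt} {r : Srt}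
    (t : Term S [] (.arr (prodTy gty n s) (gty r))) {i l : ℕ} (h : l ≤ i) (j : ℕ)
    (γ : (ctxD Γ).obj i) (y : (prodTy cty n s).D.obj l) :
    down r j (fap (B := cty r) h (((limit t).den I).app i γ) y) =
      fap (A := prodTy gty n s) (le_refl j) ((t.den I).app j (emptyEnv.1 j))
        (tupleD n s fun p => down (s p) j ((projHom cty n s p).app l y)) := by
  have hf : (Ty.box (.arr (prodTy gty n s) (gty r)) : Ty 0).WF := ⟨prodTy_wf gty_wf n s, gty_wf r⟩
  have hy : (prodTy cty n s).WF := prodTy_wf cty_wf n s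
  have hc := ctxD_isConst (cons_const hy (prodTy_const cty_const n s)
    (cons_const hf trivial nilConst))
  let F : (Ty.box (.arr (prodTy gty n s) (gty r)) : Ty 0).D.obj i :=
    ((boxNil (Γ := Γ) t).den I).app i γ
  refine (congrArg (fun g => down r j (fap (A := prodTy cty n s) (B := cty r) h g y))
    (den_beta I hf _ (boxNil t) i γ)).trans ?_
  refine (congrArg (down r j) (fap_lam I hy _ h _ y)).trans ?_
  refine (down_den_relift I r _ l j _).trans ?_
  let δ := takeEnv (Γ := Γ) [prodTy cty n s, .box (.arr (prodTy gty n s) (gty r))]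
    (consEnv ((ctxD _).restr h (consEnv γ F)) y)
  -- The boxed function is moved from stage `i` to `l` and then to `j`; its object is constant, so
  -- it remains the same global element.
  have e1 : (globOf (A := .arr (prodTy gty n s) (gty r)) (i := j)
      ((hc.glob l δ).1 j _ (.s .z))).1 j = (t.den I).app j (emptyEnv.1 j) := by
    refine (congrArg (fun x => (globOf (A := .arr (prodTy gty n s) (gty r)) (i := i) x).1 j)
      ((glob_var hc (B := .box (.arr (prodTy gty n s) (gty r))) (Tree.Hom.id _) (.s .z) l j
        δ).trans ((ctxD_restr h (consEnv γ F) _ .z).trans (Tree.restr_const h F)))).trans ?_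
    exact congrArg _ (env_nil_eq _ _)
  refine congrArg₂ (fun f x => fap (A := prodTy gty n s) (B := gty r) (le_refl j) f x) e1 ?_
  refine (den_tuple I n s _ j _).trans (congrArg (tupleD n s) (funext fun p => ?_))
  refine (den_unlift I _ _ j _).trans ?_
  rw [den_proj]
  exact glob_var hc ((downHom (s p) j).comp (projHom cty n s p)) .z l j δ

/-! #### Guarded application -/

/-- The application of a curried function. -/
def curriedApp {B : Ty 0} {i : ℕ} : (n : ℕ) → (s : Fin n → Srt) → (curryTy gty B n s).D.obj i →
    (∀ p, (gty (s p)).D.obj i) → B.D.obj i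
  | 0, _, f, _ => f
  | n + 1, s, f, a => curriedApp n (fun p => s p.succ)
      (fap (A := gty (s 0)) (B := curryTy gty B n fun p => s p.succ) (le_refl i) f (a 0))
      fun p => a p.succ

/-- The context varies in the induction because the recursive call of `curryTm` sits beneath two
abstractions. -/
theorem curriedApp_curryTm {B : Ty 0} (hB : B.WF) (n : ℕ) : ∀ (Γ : List (Ty 0)) (s : Fin n → Srt)
    (i : ℕ) (γ : (ctxD Γ).obj i) (f : (Ty.arr (prodTy gty n s) B).D.obj i)
    (a : ∀ p, (gty (s p)).D.obj i),
    curriedApp n s (fap (A := .arr (prodTy gty n s) B) (le_refl i)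
      (((curryTm (S := S) gty_wf hB n s).den I).app i γ) f) a = fap le_rfl f (tupleD n s a) := by
  induction n with
  | zero => exact fun Γ s i γ f a => fap_lam_self I _ _ γ f
  | succ n ih =>
    intro Γ s i γ f a
    refine (congrArg (fun g => curriedApp (B := B) n (fun p => s p.succ)
      (fap (A := gty (s 0)) (B := curryTy gty B n fun p => s p.succ) (le_refl i) g (a 0))
      fun p => a p.succ) (fap_lam_self I (A := .arr (prodTy gty (n + 1) s) B)
        (B := .arr (gty (s 0)) (curryTy gty B n fun p => s p.succ)) _ _ γ f)).trans ?_
    refine (congrArg (fun g => curriedApp (B := B) n (fun p => s p.succ) g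
      fun p => a p.succ) (fap_lam_self I (A := gty (s 0)) _ _ _ (a 0))).trans ?_
    refine (ih _ (fun p => s p.succ) i _ _ fun p => a p.succ).trans ?_
    exact fap_lam_self I (A := prodTy gty n fun p => s p.succ) _ _ _ _

theorem den_apList {B : Ty 0} (n : ℕ) : ∀ (s : Fin n → Srt)
    (u : Term S Γ (.later (curryTy gty B n s))) (a : ∀ p, Term S Γ (.later (gty (s p)))) (i : ℕ)
    (γ : (ctxD Γ).obj (i + 1)),
    ((apList n s u a).den I).app (i + 1) γ =
      curriedApp (B := B) (i := i) n s ((u.den I).app (i + 1) γ)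
        fun p => ((a p).den I).app (i + 1) γ := by
  induction n with
  | zero => exact fun _ _ _ _ _ => rfl
  | succ n ih => exact fun s u a i γ => ih _ (.ap u (a 0)) (fun p => a p.succ) i γ

/-- At stage `i + 1` each `⊛` is application at stage `i`, and the curried function is undone by the
arguments. -/
theorem den_gapp {n : ℕ} {s : Fin n → Srt} {r : Srt}
    (u : Term S Γ (.later (.arr (prodTy gty n s) (gty r))))
    (a : ∀ p, Term S Γ (.later (gty (s p)))) (i : ℕ) (γ : (ctxD Γ).obj (i + 1)) :
    ((gapp u a).den I).app (i + 1) γ =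
      fap (A := prodTy gty n s) (B := gty r) (le_refl i) ((u.den I).app (i + 1) γ)
        (tupleD n s fun p => ((a p).den I).app (i + 1) γ) := by
  refine (den_apList I n s _ a i γ).trans ?_
  refine Eq.trans ?_ (curriedApp_curryTm (B := gty r) I (gty_wf r) n Γ s i ((ctxD Γ).res i γ) _ _)
  refine (congrArg (fun f => curriedApp (B := gty r) (i := i) n s f
    fun p => ((a p).den I).app (i + 1) γ) (den_ap_succ I _ u i γ)).trans ?_
  refine congrArg (fun g => curriedApp (B := gty r) (i := i) n s
    (fap (A := .arr (prodTy gty n s) (gty r)) (B := curryTy gty (gty r) n s) (le_refl i) g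
      ((u.den I).app (i + 1) γ)) fun p => ((a p).den I).app (i + 1) γ) ?_
  exact den_next_succ I (curryTm gty_wf (gty_wf r) n s) i γ

end


/-! ### Behavioural differential equations -/

section

variable {Sg : Sig} (I : ∀ A, Sym Sg A → A.D.Glob) {Γ Γ' : List (Ty 0)} {k : ℕ}

theorem den_gHead {X : Fin k → Term (Sym Sg) Γ .nat} {X' : Fin k → Term (Sym Sg) Γ' .nat}
    {i j : ℕ} {γ : (ctxD Γ).obj i} {γ' : (ctxD Γ').obj j}
    (hX : ∀ p, ((X' p).den I).app j γ' = ((X p).den I).app i γ) {s : Srt}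
    (t : FTm Sg (HeadVar k) s) :
    ((gHead X' t).den I).app j γ' = down s j (((cHead X t).den I).app i γ) := by
  induction t with
  | var v => cases v with | x p => exact hX p
  | op g a ih =>
    refine (den_app I _ _ j γ').trans ?_
    refine Eq.trans ?_ (congrArg (down (Sg.cod g) j) (den_app I (A := prodTy cty _ _)
      (limit (.atom (.mk g))) (tuple _ _ fun p => cHead X (a p)) i γ)).symm
    refine Eq.trans ?_ (down_limit I _ le_rfl j γ _).symm
    rw [den_tuple, den_tuple]
    simp only [projHom_tupleD]
    exact congrArg (fap (A := prodTy gty _ _) (B := gty (Sg.cod g)) (le_refl j) _)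
      (congrArg (tupleD _ _) (funext ih))

/-- Compares stage `j + 1` of the guarded reading with component `j` of the coinductive one: the
guarded term lives under `later`. Hence terms read beneath `next` are compared at stage `j`, and
`Z'` and `F'`, themselves under `later`, at stage `j + 1`. -/
theorem den_gTail {X Y Z : Fin k → Term (Sym Sg) Γ cStr}
    {F : Term (Sym Sg) Γ (.arr (prodTy cty k fun _ => .str) cStr)}
    {X' Y' : Fin k → Term (Sym Sg) Γ' gStr} {Z' : Fin k → Term (Sym Sg) Γ' (.later gStr)}
    {F' : Term (Sym Sg) Γ' (.later (.arr (prodTy gty k fun _ => .str) gStr))}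
    {i j : ℕ} {γ : (ctxD Γ).obj i} {γ' : (ctxD Γ').obj (j + 1)}
    (hX : ∀ p, ((X' p).den I).app j ((ctxD Γ').res j γ') = (globOf (((X p).den I).app i γ)).1 j)
    (hY : ∀ p, ((Y' p).den I).app j ((ctxD Γ').res j γ') = (globOf (((Y p).den I).app i γ)).1 j)
    (hZ : ∀ p, ((Z' p).den I).app (j + 1) γ' = (globOf (((Z p).den I).app i γ)).1 j)
    (hF : ∀ y : (prodTy cty k fun _ => .str).D.obj i,
      (globOf (A := gStr) (i := i) (fap (A := prodTy cty k fun _ => .str) (B := cStr) le_rfl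
        ((F.den I).app i γ) y)).1 j =
      fap (A := prodTy gty k fun _ => .str) (B := gStr) (le_refl j) ((F'.den I).app (j + 1) γ')
        (tupleD k (fun _ => .str) fun p => down .str j ((projHom cty k (fun _ => .str) p).app i y)))
    {s : Srt} (t : FTm (Sg.withSelf k) (TailVar k) s) :
    ((gTail X' Y' Z' F' t).den I).app (j + 1) γ' =
      down s j (((cTail X Y Z F t).den I).app i γ) := by
  induction t with
  | var v =>
    cases v with
    | x p => exact (den_next_succ I _ j γ').trans (hX p)
    | y p => exact (den_next_succ I _ j γ').trans (hY p)
    | z p => exact hZ p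
  | op g a ih =>
    cases g with
    | none =>
      refine (den_gapp I (s := fun _ => .str) (r := .str) F' _ j γ').trans ?_
      refine Eq.trans ?_ (congrArg (down .str j) (den_app I (A := prodTy cty k fun _ => .str)
        F (tuple (T := cty) k (fun _ => .str) fun p => cTail X Y Z F (a p)) i γ)).symm
      refine Eq.trans ?_ (hF _).symm
      rw [den_tuple]
      simp only [projHom_tupleD]
      exact congrArg (fap (A := prodTy gty k fun _ => .str) (B := gStr) (le_refl j) _)
        (congrArg (tupleD k fun _ => .str) (funext ih))
    | some g =>
      refine (den_gapp I (s := Sg.dom g) (r := Sg.cod g) (.next (.atom (.mk g))) _ j γ').trans ?_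
      refine Eq.trans ?_ (congrArg (down (Sg.cod g) j) (den_app I (A := prodTy cty _ _)
        (limit (.atom (.mk g))) (tuple _ _ fun p => cTail X Y Z F (a p)) i γ)).symm
      refine Eq.trans ?_ (down_limit I _ le_rfl j γ _).symm
      rw [den_tuple]
      simp only [projHom_tupleD]
      exact congrArg₂ (fap (A := prodTy gty _ _) (B := gty (Sg.cod g)) (le_refl j))
        (den_next_succ I (.atom (.mk g)) j γ')
        (congrArg (tupleD (Sg.arity g) (Sg.dom g)) (funext ih))

/-! ### The solution and its head and tail equations -/

namespace BDE

variable (e : BDE Sg k)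

theorem den_gSol (Γ : List (Ty 0)) :
    Tm.den I (.app e.gPhi (.next e.gSol)) = Tm.den I (Γ := Γ) e.gSol := by
  ext i γ
  exact (den_fix I (gFun_wf k) e.gPhi i γ).symm

/-- The head of the body of `gPhi`. -/
def gPhiHead : Term (Sym Sg) (prodTy gty k (fun _ => .str) :: .later (gFun k) :: Γ) .nat :=
  gHead (fun p => ghd (proj (T := gty) k (fun _ => .str) (.var .z) p)) e.head

/-- The tail of the body of `gPhi`. -/
def gPhiTail : Term (Sym Sg) (prodTy gty k (fun _ => .str) :: .later (gFun k) :: Γ) (.later gStr) :=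
  gTail (fun p => gcons (ghd (proj (T := gty) k (fun _ => .str) (.var .z) p)) (.next gzeros))
    (proj (T := gty) k (fun _ => .str) (.var .z))
    (fun p => gtl (proj (T := gty) k (fun _ => .str) (.var .z) p)) (.var (.s .z)) e.tail

/-- The environment in which the body of `gPhi` is evaluated. -/
noncomputable def gEnv {i : ℕ} (γ : (ctxD Γ).obj i) (v : (prodTy gty k fun _ => .str).D.obj i) :
    (ctxD (prodTy gty k (fun _ => .str) :: .later (gFun k) :: Γ)).obj i :=
  consEnv (consEnv γ ((Tree.Hom.next (gFun k).D).app i ((e.gSol.den I).app i γ))) v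

/-- The fixed point unrolled once: the recursive function in the environment has the value of `next
gSol`. -/
theorem fap_gSol {i : ℕ} (γ : (ctxD Γ).obj i) (v : (prodTy gty k fun _ => .str).D.obj i) :
    fap (A := prodTy gty k fun _ => .str) (B := gStr) le_rfl ((e.gSol.den I).app i γ) v =
      gCons.app i ((e.gPhiHead.den I).app i (e.gEnv I γ v),
        (e.gPhiTail.den I).app i (e.gEnv I γ v)) := by
  rw [← den_gSol]
  refine (congrArg (fun f => fap (A := prodTy gty k fun _ => .str) (B := gStr) (le_refl i) f v)
    (den_beta I (A := .later (gFun k)) (B := gFun k) _ _ (.next e.gSol) i γ)).trans ?_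
  refine (fap_lam_self I (A := prodTy gty k fun _ => .str) (B := gStr) _ _ _ v).trans ?_
  exact den_gcons I _ _ i _

/-- The term `F` denotes the same function as the lifting of `gSol`. -/
def DenotesSol {i : ℕ} (γ : (ctxD Γ).obj i) (F : Term (Sym Sg) Γ (cFun k)) : Prop :=
  ∀ (y : (prodTy cty k fun _ => .str).D.obj i) (j : ℕ),
    (globOf (A := gStr) (i := i) (fap (A := prodTy cty k fun _ => .str) (B := cStr) le_rfl
      ((F.den I).app i γ) y)).1 j =
    fap (A := prodTy gty k fun _ => .str) (B := gStr) (le_refl j)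
      ((e.gSol.den I).app j (emptyEnv.1 j))
      (tupleD k (fun _ => .str) fun p => down .str j ((projHom cty k (fun _ => .str) p).app i y))

theorem denotesSol_cSol {i : ℕ} (γ : (ctxD Γ).obj i) : e.DenotesSol I γ e.cSol :=
  fun y j => down_limit I (s := fun _ => .str) (r := .str) e.gSol le_rfl j γ y

/-- In any context this is a renaming of the same closed term, so the environment is irrelevant. -/
theorem den_gzeros {Γ Γ' : List (Ty 0)} {i : ℕ} (γ : (ctxD Γ).obj i) (γ' : (ctxD Γ').obj i) :
    (Tm.den I gzeros).app i γ = (Tm.den I gzeros).app i γ' := by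
  have key : ∀ {Γ : List (Ty 0)} (γ : (ctxD Γ).obj i),
      (Tm.den I gzeros).app i γ = (Tm.den I gzeros).app i (emptyEnv.1 i) := by
    intro Γ γ
    have h := Tm.den_rename I (gzeros (Γ := [])) (Δ := Γ) fun _ x => nomatch x
    have h' := congrArg (fun f => f.app i γ) h
    refine Eq.trans ?_ (h'.trans (congrArg ((Tm.den I gzeros).app i) (env_nil_eq _ _)))
    rfl
  rw [key γ, key γ']

section

variable {F : Term (Sym Sg) Γ (cFun k)} {i : ℕ} {γ : (ctxD Γ).obj i}

/-- Stated for any `F` that denotes the solution: `F` is `cSol` in the head and tail equations, but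
a variable bound to it in the body of `cPhi`. -/
theorem den_app_sol (hF : e.DenotesSol I γ F)
    (v : Term (Sym Sg) Γ (prodTy cty k fun _ => .str)) (j : ℕ) :
    (globOf ((Tm.den I (.app F v)).app i γ)).1 j =
    gCons.app j ((e.gPhiHead.den I).app j (e.gEnv I (emptyEnv.1 j)
        (tupleD k (fun _ => .str) fun p =>
          (globOf (((proj (T := cty) k (fun _ => .str) v p).den I).app i γ)).1 j)),
      (e.gPhiTail.den I).app j (e.gEnv I (emptyEnv.1 j) (tupleD k (fun _ => .str) fun p =>
          (globOf (((proj (T := cty) k (fun _ => .str) v p).den I).app i γ)).1 j))) := by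
  refine (hF ((v.den I).app i γ) j).trans ((e.fap_gSol I _ _).trans ?_)
  simp only [den_proj]
  rfl

theorem den_chd_app (hF : e.DenotesSol I γ F)
    (v : Term (Sym Sg) Γ (prodTy cty k fun _ => .str)) :
    (Tm.den I (chd (.app F v))).app i γ =
    (Tm.den I (e.headRhs (proj (T := cty) k (fun _ => .str) v))).app i γ := by
  refine (congrArg (gHd.app i) (e.den_app_sol I hF v i)).trans ((gHd_gCons i _ _).trans ?_)
  refine den_gHead I (s := .base) (fun p => ?_) e.head
  refine congrArg (gHd.app i) ((den_proj I k (fun _ => .str) _ p i _).trans ?_)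
  exact projHom_tupleD k (fun _ => .str) _ p

theorem den_ctl_app (hF : e.DenotesSol I γ F)
    (v : Term (Sym Sg) Γ (prodTy cty k fun _ => .str)) :
    (Tm.den I (ctl (.app F v))).app i γ =
    (Tm.den I (e.tailRhs F (proj (T := cty) k (fun _ => .str) v))).app i γ := by
  refine Subtype.ext (funext fun j => ?_)
  refine (den_ctl I _ i j γ).trans ?_
  refine (congrArg (gTl.app (j + 1)) (e.den_app_sol I hF v (j + 1))).trans
    ((gTl_gCons (j + 1) _ _).trans ?_)
  set y : Fin k → gStr.D.Glob := fun p =>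
    globOf (((proj (T := cty) k (fun _ => .str) v p).den I).app i γ)
  have hproj : ∀ (p : Fin k) (j : ℕ), ((proj (T := gty) k (fun _ => .str) (.var .z) p).den I).app j
      (e.gEnv I (emptyEnv.1 j) (tupleD k (fun _ => .str) fun p => (y p).1 j)) = (y p).1 j :=
    fun p j => (den_proj I k (fun _ => .str) _ p j _).trans (projHom_tupleD k (fun _ => .str) _ p)
  -- The variables `xᵢ` and `yᵢ` are read beneath `next`, so they are evaluated at stage `j` in the
  -- restriction of the environment at `j + 1`.
  have hproj' : ∀ (p : Fin k), ((proj (T := gty) k (fun _ => .str) (.var .z) p).den I).app j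
      ((ctxD _).res j (e.gEnv I (emptyEnv.1 (j + 1))
        (tupleD k (fun _ => .str) fun p => (y p).1 (j + 1)))) = (y p).1 j := fun p => by
    refine (((proj (T := gty) k (fun _ => .str) (.var .z) p).den I).naturality j _).symm.trans ?_
    exact (congrArg (gStr.D.res j) (hproj p (j + 1))).trans ((y p).2 j)
  refine den_gTail I (s := .str) (fun p => ?_) hproj' (fun p => ?_) (fun w => ?_) e.tail
  · have e0 : ∀ {Γ' : List (Ty 0)} (δ : (ctxD Γ').obj j), (Tm.den I gzeros).app j δ =
        (globOf ((Tm.den I (czeros (Γ := Γ))).app i γ)).1 j := fun {_} δ =>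
      den_gzeros I δ (((ctxD_isConst nilConst).glob i
        ((tupleHom fun B x => (nilSubst B x).den I).app i γ)).1 j)
    refine (den_gcons I _ _ j _).trans (Eq.trans ?_ (den_ccons I _ _ i j γ).symm)
    refine congrArg₂ (fun n s => gCons.app j (n, s)) ?_
      (congrArg ((Tree.Hom.next gStr.D).app j) (e0 _))
    -- The guarded side takes the head at stage `j`, the coinductive side at stage `i`.
    exact (congrArg (gHd.app j) (hproj' p)).trans (gHd_glob (y p) j i)
  · refine Eq.trans ?_ (den_ctl I _ i j γ).symm
    exact congrArg (gTl.app (j + 1)) (hproj p (j + 1))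
  -- Recursive calls: at stage `j + 1` the variable `f` holds `next gSol`, that is, `gSol` at stage
  -- `j`, as component `j` of the lifting requires.
  · refine (hF w j).trans ?_
    refine congrArg (fun f => fap (A := prodTy gty k fun _ => .str) (B := gStr) (le_refl j) f _) ?_
    refine Eq.trans ?_ ((e.gSol.den I).naturality j (emptyEnv.1 (j + 1))).symm
    exact congrArg ((e.gSol.den I).app j) (env_nil_eq _ _)

/-- Read backwards, the head and tail equations turn the left side into the cons of the head and
tail of `F v`, which is `F v`. -/
theorem den_ccons_app (hF : e.DenotesSol I γ F)
    (v : Term (Sym Sg) Γ (prodTy cty k fun _ => .str)) :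
    (Tm.den I (ccons (e.headRhs (proj (T := cty) k (fun _ => .str) v))
      (e.tailRhs F (proj (T := cty) k (fun _ => .str) v)))).app i γ =
    (Tm.den I (.app F v)).app i γ := by
  refine Subtype.ext (funext fun j => ?_)
  refine (den_ccons I _ _ i j γ).trans ?_
  rw [← e.den_chd_app I hF, ← e.den_ctl_app I hF]
  refine Eq.trans ?_ (gCons_eta j _)
  refine congrArg₂ (fun n s => gCons.app j (n, s)) (gHd_glob _ i j) ?_
  -- At stage `0` both tails are the point. At `j + 1`, `next` restricts the tail to its component
  -- `j`, which is the guarded tail of component `j + 1` of `F v`.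
  cases j with
  | zero => rfl
  | succ j =>
    refine ((globOf ((Tm.den I (ctl (.app F v))).app i γ)).2 j).trans ?_
    exact den_ctl I _ i j γ

end

theorem den_cPhi (Γ : List (Ty 0)) :
    Tm.den I (.app e.cPhi e.cSol) = Tm.den I (Γ := Γ) e.cSol := by
  ext i γ
  refine fap_ext (A := prodTy cty k fun _ => .str) (B := cStr) fun j hj w => ?_
  refine (congrArg (fun f => fap (A := prodTy cty k fun _ => .str) (B := cStr) hj f w)
    (den_beta I (A := cFun k) (B := cFun k) _ _ e.cSol i γ)).trans ?_
  refine (fap_lam I (A := prodTy cty k fun _ => .str) (B := cStr) _ _ hj _ w).trans ?_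
  have hr : ∀ w, fap (A := prodTy cty k fun _ => .str) (B := cStr) le_rfl
      ((ctxD (cFun k :: Γ)).restr hj (consEnv γ ((e.cSol.den I).app i γ)) (cFun k) .z) w =
      fap (A := prodTy cty k fun _ => .str) (B := cStr) hj ((e.cSol.den I).app i γ) w := fun w => by
    refine (congrArg (fun f => fap (A := prodTy cty k fun _ => .str) (B := cStr) (le_refl j) f w)
      (ctxD_restr hj _ _ _)).trans ?_
    exact fap_restr (A := prodTy cty k fun _ => .str) (B := cStr) hj _ w
  -- In the body of `cPhi` the recursive function is a variable; its value is the solution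
  -- restricted to stage `j`, which by `hr` acts as the unrestricted one and so still denotes the
  -- solution.
  refine (e.den_ccons_app I (F := .var (.s .z)) (fun w j' => ?_) (.var .z)).trans (hr w)
  refine (congrArg (fun x => (globOf (A := gStr) (i := j) x).1 j') (hr w)).trans ?_
  exact down_limit I (s := fun _ => .str) (r := .str) e.gSol hj j' γ w

end BDE

end

end GLambda

/-! ### The theorem -/

open GLambda in
theorem theorem4p5 (Sg : Sig) (k : ℕ) (e : BDE Sg k) :
    (∀ I : Interp Sg,
      -- `gSol` is the unique fixed point of `gPhi`
      I.Eq (Γ := []) (.app e.gPhi (.next e.gSol)) e.gSol ∧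
      (∀ u : Term (Sym Sg) [] (gFun k), I.Eq (.app e.gPhi (.next u)) u → I.Eq u e.gSol) ∧
      -- its lifting `cSol` is a fixed point of `cPhi`
      I.Eq (Γ := []) (.app e.cPhi e.cSol) e.cSol ∧
      -- `cSol` satisfies the head and tail equations
      (let Γ : List (Ty 0) := [prodTy cty k fun _ => .str]
       let ys : Term (Sym Sg) Γ (prodTy cty k fun _ => .str) := .var .z
       let y : Fin k → Term (Sym Sg) Γ cStr := proj (T := cty) k (fun _ => .str) ys
       I.Eq (chd (.app e.cSol ys)) (e.headRhs y) ∧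
       I.Eq (ctl (.app e.cSol ys)) (e.tailRhs e.cSol y))) ∧
    -- the same equations up to contextual equivalence
    (∀ E : Impl Sg,
      E.Eq (Γ := []) (.app e.gPhi (.next e.gSol)) e.gSol ∧
      E.Eq (Γ := []) (.app e.cPhi e.cSol) e.cSol ∧
      (let Γ : List (Ty 0) := [prodTy cty k fun _ => .str]
       let ys : Term (Sym Sg) Γ (prodTy cty k fun _ => .str) := .var .z
       let y : Fin k → Term (Sym Sg) Γ cStr := proj (T := cty) k (fun _ => .str) ys
       E.Eq (chd (.app e.cSol ys)) (e.headRhs y) ∧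
       E.Eq (ctl (.app e.cSol ys)) (e.tailRhs e.cSol y))) := by
  refine ⟨fun I => ⟨e.den_gSol _ _, fun u hu => fix_unique _ _ _ u hu, e.den_cPhi _ _, ?_, ?_⟩,
    -- The equations are proved for any assignment of global elements to the symbols, so `E.glob`
    -- can replace the interpretation of part (1).
    fun E => ⟨E.eq_of_den_eq (e.den_gSol _ _), E.eq_of_den_eq (e.den_cPhi _ _),
      E.eq_of_den_eq ?_, E.eq_of_den_eq ?_⟩⟩
  · exact Tree.Hom.ext (funext₂ fun _ γ => e.den_chd_app _ (e.denotesSol_cSol _ γ) _)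
  · exact Tree.Hom.ext (funext₂ fun _ γ => e.den_ctl_app _ (e.denotesSol_cSol _ γ) _)
  · exact Tree.Hom.ext (funext₂ fun _ γ => e.den_chd_app _ (e.denotesSol_cSol _ γ) _)
  · exact Tree.Hom.ext (funext₂ fun _ γ => e.den_ctl_app _ (e.denotesSol_cSol _ γ) _)
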